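/- A finite clause set over two sorts is considered: a base sort $\mathcal R$, interpreted by the real numbers $\mathbb R$, and a free sort $\mathcal S$, interpreted by an arbitrary nonempty domain. Ground linear arithmetic terms are built from rational constants and base-sort Skolem constants (which an interpretation maps to arbitrary reals) by $+$ and $-$. A BSR(SLR) clause has the form $\Lambda \,\|\, \Gamma \to \Delta$ with finite multisets $\Lambda,\Gamma,\Delta$ of atoms such that (i) every atom in $\Lambda$ has the form $s \triangleleft t$, $x \triangleleft t$ or $x \triangleleft y$, where $s,t$ are ground linear arithmetic terms, $x,y$ are base-sort variables, and $\triangleleft \in \{<,\le,=,\neq,\ge,>\}$; (ii) every atom in $\Gamma$ and $\Delta$ is either an equation $s \approx s'$ between free-sort variables and free-sort constant symbols, or a well-sorted atom $P(s_1,\dots,s_m)$, $m \ge 0$, where $P$ is an uninterpreted predicate symbol of sort $\xi_1\times\dots\times\xi_m$ with $\xi_i\in\{\mathcal R,\mathcal S\}$ and each $s_i$ is a base-sort variable, a free-sort variable or a free-sort constant symbol. An interpretation $\mathcal A$ consists of a nonempty set $\mathcal S^{\mathcal A}$, a real number for every base-sort Skolem constant, an element of $\mathcal S^{\mathcal A}$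 for every free-sort constant symbol, and a set $P^{\mathcal A}\subseteq \xi_1^{\mathcal A}\times\dots\times\xi_m^{\mathcal A}$ for every predicate symbol $P$ of sort $\xi_1\times\dots\times\xi_m$ (with $\mathcal R^{\mathcal A}=\mathbb R$); arithmetic and $\approx$ are interpreted in the standard way. It is a model of a clause set $N$ if for every clause $\Lambda \,\|\, \Gamma \to \Delta$ in $N$ the formula $(\bigwedge\Lambda\wedge\bigwedge\Gamma)\to\bigvee\Delta$ holds under every sort-respecting assignment of values to the variables. $N$ is satisfiable if it has a model. **Theorem.** Satisfiability of finite BSR(SLR) clause sets is decidable, i.e. there is an algorithm which, given any finite BSR(SLR) clause set $N$, decides whether $N$ is satisfiable. -/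

import Mathlib

universe u

namespace BSRSLR

/-! ### Syntax

All symbols (base-sort variables, free-sort variables, base-sort Skolem constants, free-sort
constants, predicate names) are taken from countably infinite supplies, each indexed by `ℕ`. -/

/-- The relation symbols `<, ≤, =, ≠, ≥, >` on the base sort. -/
inductive Rel where
  | lt | le | eq | ne | ge | gt

/-- Ground (variable-free) linear arithmetic terms: numerals `num / den` for the rational
constants, base-sort Skolem constants, and the operators `+` and `-` (binary and unary). -/
inductive GTerm where
  | rat (num : ℤ) (den : ℕ+)
  | skolem (c : ℕ)
  | neg (s : GTerm)
  | add (s t : GTerm)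
  | sub (s t : GTerm)

/-- Linear arithmetic constraints `s ◁ t`, `x ◁ t`, `x ◁ y` with `s, t` ground terms and
`x, y` base-sort variables. -/
inductive Constraint where
  | ground (s : GTerm) (r : Rel) (t : GTerm)
  | varTerm (x : ℕ) (r : Rel) (t : GTerm)
  | varVar (x : ℕ) (r : Rel) (y : ℕ)

/-- Free-sort terms: variables and constant symbols. -/
inductive FTerm where
  | var (v : ℕ)
  | const (c : ℕ)

/-- Arguments of free predicate symbols: base-sort variables and free-sort terms. -/
inductive Arg where
  | base (x : ℕ)
  | free (s : FTerm)

/-- Free atoms: equations between free-sort terms, and atoms `P(s₁, …, sₘ)`.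
A predicate symbol is given by its name together with its sort `ξ₁ × ⋯ × ξₘ`; in an atom, the
latter is read off from the arguments, so that every atom is well sorted (and the same name used
with two different sorts stands for two different predicate symbols). -/
inductive Atom where
  | eq (s t : FTerm)
  | pred (P : ℕ) (args : List Arg)

/-- A BSR(SLR) clause `Λ ‖ Γ → Δ`; the finite multisets `Λ`, `Γ`, `Δ` are listed. -/
structure Clause where
  constraints : List Constraint
  antecedent : List Atom
  succedent : List Atom

/-- A finite clause set, given by a list of its elements. -/
abbrev ClauseSet := List Clause

/-! ### Semantics -/

/-- Standard interpretation of the relation symbols over the reals. -/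
def Rel.Holds : Rel → ℝ → ℝ → Prop
  | .lt, a, b => a < b
  | .le, a, b => a ≤ b
  | .eq, a, b => a = b
  | .ne, a, b => a ≠ b
  | .ge, a, b => a ≥ b
  | .gt, a, b => a > b

/-- A hierarchic interpretation. The base sort is `ℝ`, the free sort is a nonempty domain.
A tuple of arguments is a list of elements of the disjoint union of the two sorts, so the
predicate symbol with name `P` and sort `ξ₁ × ⋯ × ξₘ` is interpreted by the set of those tuples
in `pred P` that have length `m` and whose `i`-th entry is of sort `ξᵢ`. -/
structure Interpretation where
  Dom : Type u
  nonempty : Nonempty Dom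
  skolem : ℕ → ℝ
  const : ℕ → Dom
  pred : ℕ → Set (List (ℝ ⊕ Dom))

/-- A sort-respecting variable assignment. -/
structure Assignment (A : Interpretation.{u}) where
  base : ℕ → ℝ
  free : ℕ → A.Dom

/-- The real value of a ground term. -/
noncomputable def GTerm.val (A : Interpretation.{u}) : GTerm → ℝ
  | .rat n d => (n : ℝ) / ((d : ℕ) : ℝ)
  | .skolem c => A.skolem c
  | .neg s => -(s.val A)
  | .add s t => s.val A + t.val A
  | .sub s t => s.val A - t.val A

def Constraint.Holds (A : Interpretation.{u}) (β : Assignment A) : Constraint → Prop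
  | .ground s r t => r.Holds (s.val A) (t.val A)
  | .varTerm x r t => r.Holds (β.base x) (t.val A)
  | .varVar x r y => r.Holds (β.base x) (β.base y)

def FTerm.val (A : Interpretation.{u}) (β : Assignment A) : FTerm → A.Dom
  | .var v => β.free v
  | .const c => A.const c

def Arg.val (A : Interpretation.{u}) (β : Assignment A) : Arg → ℝ ⊕ A.Dom
  | .base x => Sum.inl (β.base x)
  | .free s => Sum.inr (s.val A β)

def Atom.Holds (A : Interpretation.{u}) (β : Assignment A) : Atom → Prop
  | .eq s t => s.val A β = t.val A β
  | .pred P args => args.map (Arg.val A β) ∈ A.pred P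

/-- `A, β ⊨ Λ ‖ Γ → Δ`, i.e. `(⋀ Λ ∧ ⋀ Γ) → ⋁ Δ`. -/
def Clause.Holds (A : Interpretation.{u}) (β : Assignment A) (C : Clause) : Prop :=
  ((∀ a ∈ C.constraints, a.Holds A β) ∧ (∀ a ∈ C.antecedent, a.Holds A β)) →
    ∃ a ∈ C.succedent, a.Holds A β

/-- `A` is a model of `N`: every clause of `N` holds under every variable assignment. -/
def Interpretation.IsModel (A : Interpretation.{u}) (N : ClauseSet) : Prop :=
  ∀ C ∈ N, ∀ β : Assignment A, C.Holds A β

/-- `N` has a (hierarchic) model. -/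
def Satisfiable (N : ClauseSet) : Prop :=
  ∃ A : Interpretation.{u}, A.IsModel N

/-! ### Coding of the syntax by natural numbers

Terms are coded as syntax trees; everything else is coded through products, sums and lists. -/

def GTerm.toNat : GTerm → ℕ
  | .rat n d => 5 * Nat.pair (Equiv.intEquivNat n) d.natPred
  | .skolem c => 5 * c + 1
  | .neg s => 5 * s.toNat + 2
  | .add s t => 5 * Nat.pair s.toNat t.toNat + 3
  | .sub s t => 5 * Nat.pair s.toNat t.toNat + 4

def GTerm.ofNat (n : ℕ) : GTerm :=
  if h0 : n % 5 = 0 then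
    .rat (Equiv.intEquivNat.symm (n / 5).unpair.1) (n / 5).unpair.2.succPNat
  else if n % 5 = 1 then .skolem (n / 5)
  else
    have hn : n / 5 < n := by omega
    have h1 : (n / 5).unpair.1 < n := lt_of_le_of_lt (Nat.unpair_left_le _) hn
    have h2 : (n / 5).unpair.2 < n := lt_of_le_of_lt (Nat.unpair_right_le _) hn
    if n % 5 = 2 then .neg (GTerm.ofNat (n / 5))
    else if n % 5 = 3 then
      .add (GTerm.ofNat (n / 5).unpair.1) (GTerm.ofNat (n / 5).unpair.2)
    else .sub (GTerm.ofNat (n / 5).unpair.1) (GTerm.ofNat (n / 5).unpair.2)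
termination_by n

theorem GTerm.ofNat_toNat (t : GTerm) : GTerm.ofNat t.toNat = t := by
  induction t with
  | rat n d =>
    rw [GTerm.ofNat]
    simp [GTerm.toNat]
  | skolem c =>
    rw [GTerm.ofNat]
    have h : (5 * c + 1) / 5 = c := by omega
    simp [GTerm.toNat, Nat.add_mod, h]
  | neg s ih =>
    rw [GTerm.ofNat]
    have h : (5 * s.toNat + 2) / 5 = s.toNat := by omega
    simp [GTerm.toNat, Nat.add_mod, h, ih]
  | add s t ih1 ih2 =>
    rw [GTerm.ofNat]
    have h : (5 * Nat.pair s.toNat t.toNat + 3) / 5 = Nat.pair s.toNat t.toNat := by omega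
    simp [GTerm.toNat, Nat.add_mod, h, ih1, ih2]
  | sub s t ih1 ih2 =>
    rw [GTerm.ofNat]
    have h : (5 * Nat.pair s.toNat t.toNat + 4) / 5 = Nat.pair s.toNat t.toNat := by omega
    simp [GTerm.toNat, Nat.add_mod, h, ih1, ih2]

theorem GTerm.toNat_ofNat (n : ℕ) : (GTerm.ofNat n).toNat = n := by
  induction n using Nat.strong_induction_on with
  | _ n ih =>
    rw [GTerm.ofNat]
    split_ifs with h0 h1 h2 h3
    · simp only [GTerm.toNat, Equiv.apply_symm_apply, Nat.natPred_succPNat, Nat.pair_unpair]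
      omega
    · simp only [GTerm.toNat]
      omega
    · simp only [GTerm.toNat]
      rw [ih _ (by omega)]
      omega
    all_goals
      have hn : n / 5 < n := by omega
      simp only [GTerm.toNat]
      rw [ih _ (lt_of_le_of_lt (Nat.unpair_left_le _) hn),
        ih _ (lt_of_le_of_lt (Nat.unpair_right_le _) hn), Nat.pair_unpair]
      omega

instance : Denumerable GTerm :=
  Denumerable.mk' ⟨GTerm.toNat, GTerm.ofNat, GTerm.ofNat_toNat, GTerm.toNat_ofNat⟩

def Rel.equiv : Rel ≃ Fin 6 where
  toFun
    | .lt => 0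
    | .le => 1
    | .eq => 2
    | .ne => 3
    | .ge => 4
    | .gt => 5
  invFun
    | 0 => .lt
    | 1 => .le
    | 2 => .eq
    | 3 => .ne
    | 4 => .ge
    | 5 => .gt
  left_inv r := by cases r <;> rfl
  right_inv i := by fin_cases i <;> rfl

instance : Primcodable Rel := Primcodable.ofEquiv _ Rel.equiv

def Constraint.equiv :
    Constraint ≃ (GTerm × Rel × GTerm) ⊕ (ℕ × Rel × GTerm) ⊕ (ℕ × Rel × ℕ) where
  toFun
    | .ground s r t => .inl (s, r, t)
    | .varTerm x r t => .inr (.inl (x, r, t))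
    | .varVar x r y => .inr (.inr (x, r, y))
  invFun
    | .inl (s, r, t) => .ground s r t
    | .inr (.inl (x, r, t)) => .varTerm x r t
    | .inr (.inr (x, r, y)) => .varVar x r y
  left_inv a := by cases a <;> rfl
  right_inv a := by rcases a with ⟨_, _, _⟩ | ⟨_, _, _⟩ | ⟨_, _, _⟩ <;> rfl

instance : Primcodable Constraint := Primcodable.ofEquiv _ Constraint.equiv

def FTerm.equiv : FTerm ≃ ℕ ⊕ ℕ where
  toFun
    | .var v => .inl v
    | .const c => .inr c
  invFun
    | .inl v => .var v
    | .inr c => .const c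
  left_inv a := by cases a <;> rfl
  right_inv a := by cases a <;> rfl

instance : Primcodable FTerm := Primcodable.ofEquiv _ FTerm.equiv

def Arg.equiv : Arg ≃ ℕ ⊕ FTerm where
  toFun
    | .base x => .inl x
    | .free s => .inr s
  invFun
    | .inl x => .base x
    | .inr s => .free s
  left_inv a := by cases a <;> rfl
  right_inv a := by cases a <;> rfl

instance : Primcodable Arg := Primcodable.ofEquiv _ Arg.equiv

def Atom.equiv : Atom ≃ (FTerm × FTerm) ⊕ (ℕ × List Arg) where
  toFun
    | .eq s t => .inl (s, t)
    | .pred P l => .inr (P, l)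
  invFun
    | .inl (s, t) => .eq s t
    | .inr (P, l) => .pred P l
  left_inv a := by cases a <;> rfl
  right_inv a := by rcases a with ⟨_, _⟩ | ⟨_, _⟩ <;> rfl

instance : Primcodable Atom := Primcodable.ofEquiv _ Atom.equiv

def Clause.equiv : Clause ≃ List Constraint × List Atom × List Atom where
  toFun C := (C.constraints, C.antecedent, C.succedent)
  invFun p := ⟨p.1, p.2.1, p.2.2⟩
  left_inv _ := rfl
  right_inv _ := rfl

instance : Primcodable Clause := Primcodable.ofEquiv _ Clause.equiv

end BSRSLR

/-! Only finitely much about a model matters. Let `n` bound every symbol index, term code and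
argument list length in `N`. On the arithmetic side, only the order type `ρ` of the values of the
ground terms with code below `n` counts: these values are cuts in the real line, and a clause sees
its base-sort variables only through their order relative to each other and to the cuts, and through
the predicates.

The predicates are tamed by Ramsey's theorem. In a given model one finds finitely many reals,
sufficiently many in each gap between cuts, such that on tuples of these points each relevant
predicate depends only on the type of the tuple, that is, on its order relations and free-sort
entries (`exists_uniform_points`). A model thus yields a finite table `V` of types satisfying all
clauses on a grid of natural numbers (`exists_gridSatisfiable`). Conversely, a table defines
predicates on all of ℝ, and any real assignment to the variables is imitated by grid points in the
same arrangement (`satisfiable_of_gridSatisfiable`). Since clauses are universal and there are no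
function symbols on the free sort, its domain can be cut down to the elements named by constants
with index below `n`. Hence `satisfiable_iff`: satisfiability means that some `ρ`, out of finitely
many, is realized by reals and passes a primitive recursive test.

Realizability of `ρ` is a rational system of linear equations and strict inequalities. By a
Farkas-type alternative (`exists_realizedBy_or_exists_refutedBy`), it has a rational solution or a
finite refutation with integer multiplicities, and both kinds of certificate can be checked
primitive recursively. So satisfiability and its negation are both recursively enumerable, and
Post's theorem gives decidability. -/

namespace BSRSLR

/-! ### Evaluation of ground terms over ordered fields -/

/-- The homogenized value of a ground term: Skolem constants are given by `σ`, and the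
numeral `1` is interpreted by `h`. -/
def GTerm.eval {K : Type*} [Field K] (σ : ℕ → K) (h : K) : GTerm → K
  | .rat n d => h * ((n : K) / ((d : ℕ) : K))
  | .skolem c => σ c
  | .neg s => -(s.eval σ h)
  | .add s t => s.eval σ h + t.eval σ h
  | .sub s t => s.eval σ h - t.eval σ h

theorem GTerm.val_eq_eval (A : Interpretation.{u}) (t : GTerm) : t.val A = t.eval A.skolem 1 := by
  induction t <;> simp_all [GTerm.val, GTerm.eval]

/-- Codes dominate: `skolem c` has code `5 * c + 1`, and subterms have smaller codes. One bound on
term codes therefore also bounds the Skolem constants involved. -/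
theorem GTerm.eval_congr {K : Type*} [Field K] {σ τ : ℕ → K} (h : K) (t : GTerm)
    (H : ∀ c < t.toNat, σ c = τ c) : t.eval σ h = t.eval τ h := by
  induction t with
  | rat n d => rfl
  | skolem c => exact H c (by simp only [GTerm.toNat]; omega)
  | neg s ih =>
    simp only [GTerm.eval]
    rw [ih fun c hc => H c (by simp only [GTerm.toNat]; omega)]
  | add s t ih₁ ih₂ =>
    have h₁ := Nat.left_le_pair s.toNat t.toNat
    have h₂ := Nat.right_le_pair s.toNat t.toNat
    simp only [GTerm.eval]
    rw [ih₁ fun c hc => H c (by simp only [GTerm.toNat]; omega),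
      ih₂ fun c hc => H c (by simp only [GTerm.toNat]; omega)]
  | sub s t ih₁ ih₂ =>
    have h₁ := Nat.left_le_pair s.toNat t.toNat
    have h₂ := Nat.right_le_pair s.toNat t.toNat
    simp only [GTerm.eval]
    rw [ih₁ fun c hc => H c (by simp only [GTerm.toNat]; omega),
      ih₂ fun c hc => H c (by simp only [GTerm.toNat]; omega)]

theorem GTerm.eval_cast (σ : ℕ → ℚ) (h : ℚ) (t : GTerm) :
    ((t.eval σ h : ℚ) : ℝ) = t.eval (fun c => (σ c : ℝ)) h := by
  induction t <;> simp_all [GTerm.eval]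

/-- Homogeneity lets a solution with any positive `h` be rescaled to one with `h = 1`. -/
theorem GTerm.eval_smul {K : Type*} [Field K] (a : K) (σ : ℕ → K) (h : K) (t : GTerm) :
    t.eval (fun c => a * σ c) (a * h) = a * t.eval σ h := by
  induction t <;> simp_all [GTerm.eval] <;> ring

/-- The homogenized value as a linear form in the Skolem constants and the unit. -/
def GTerm.form {K : Type*} [Field K] : GTerm → (ℕ → K) × K →ₗ[K] K
  | .rat n d => ((n : K) / ((d : ℕ) : K)) • LinearMap.snd K (ℕ → K) K
  | .skolem c => LinearMap.proj c ∘ₗ LinearMap.fst K (ℕ → K) K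
  | .neg s => -s.form
  | .add s t => s.form + t.form
  | .sub s t => s.form - t.form

theorem GTerm.form_apply {K : Type*} [Field K] (t : GTerm) (p : (ℕ → K) × K) :
    t.form p = t.eval p.1 p.2 := by
  induction t with
  | rat n d => simp [GTerm.form, GTerm.eval, mul_comm]
  | _ => simp_all [GTerm.form, GTerm.eval]

/-! ### Fractions represented by natural numbers -/

/-- The triple `(p, m, d)` represents the rational number `(p - m) / (d + 1)`. -/
abbrev Frac := ℕ × ℕ × ℕ

namespace Frac

def val (x : Frac) : ℚ := ((x.1 : ℚ) - x.2.1) / (x.2.2 + 1)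

def neg (x : Frac) : Frac := (x.2.1, x.1, x.2.2)

/-- Fractions are not normalized and subtraction is avoided, so that the operations are visibly
primitive recursive. The last entry is the product of the two denominators minus one, expanded. -/
def add (x y : Frac) : Frac :=
  (x.1 * (y.2.2 + 1) + y.1 * (x.2.2 + 1), x.2.1 * (y.2.2 + 1) + y.2.1 * (x.2.2 + 1),
    x.2.2 * y.2.2 + x.2.2 + y.2.2)

def LT (x y : Frac) : Prop :=
  x.1 * (y.2.2 + 1) + y.2.1 * (x.2.2 + 1) < y.1 * (x.2.2 + 1) + x.2.1 * (y.2.2 + 1)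

theorem val_zero : val (0, 0, 0) = 0 := by simp [val]

theorem val_neg (x : Frac) : x.neg.val = -x.val := by
  simp only [val, neg]
  rw [← neg_div]
  congr 1
  ring

theorem val_add (x y : Frac) : (x.add y).val = x.val + y.val := by
  have hx : (x.2.2 : ℚ) + 1 ≠ 0 := by positivity
  have hy : (y.2.2 : ℚ) + 1 ≠ 0 := by positivity
  have hxy : (x.2.2 : ℚ) * y.2.2 + x.2.2 + y.2.2 + 1 = (x.2.2 + 1) * (y.2.2 + 1) := by ring
  simp only [val, add]
  push_cast
  rw [hxy]
  field_simp
  ring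

theorem lt_iff (x y : Frac) : x.LT y ↔ x.val < y.val := by
  simp only [LT, val]
  rw [div_lt_div_iff₀ (by positivity) (by positivity), ← Nat.cast_lt (α := ℚ)]
  push_cast
  constructor <;> intro h <;> nlinarith

theorem exists_val (q : ℚ) : ∃ x : Frac, x.val = q := by
  refine ⟨(q.num.toNat, (-q.num).toNat, q.den - 1), ?_⟩
  have h : ((q.num.toNat : ℤ) : ℚ) - (((-q.num).toNat : ℤ) : ℚ) = q.num := by
    rw [← Int.cast_sub]
    congr 1
    omega
  have hd : ((q.den - 1 : ℕ) : ℚ) + 1 = q.den := by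
    rw [← Nat.cast_succ]
    congr 1
    have := q.den_pos
    omega
  simp only [val]
  rw [hd]
  push_cast at h
  rw [h, Rat.num_div_den]

end Frac

/-- The value of a ground term, where the list `s` gives the values of the Skolem constants. -/
def GTerm.evalFrac (s : List Frac) : GTerm → Frac
  | .rat n d => (n.toNat, (-n).toNat, d.natPred)
  | .skolem c => s.getD c (0, 0, 0)
  | .neg t => (t.evalFrac s).neg
  | .add t u => (t.evalFrac s).add (u.evalFrac s)
  | .sub t u => (t.evalFrac s).add (u.evalFrac s).neg

theorem GTerm.val_evalFrac (s : List Frac) (t : GTerm) :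
    (t.evalFrac s).val = t.eval (fun c => (s.getD c (0, 0, 0)).val) 1 := by
  induction t with
  | rat n d =>
    simp only [GTerm.evalFrac, GTerm.eval, Frac.val, one_mul]
    have h : ((n.toNat : ℤ) : ℚ) - (((-n).toNat : ℤ) : ℚ) = n := by
      rw [← Int.cast_sub]
      congr 1
      omega
    rw [Int.cast_natCast, Int.cast_natCast] at h
    rw [h]
    congr 1
    rw [← Nat.cast_succ, Nat.succ_eq_add_one, PNat.natPred_add_one]
  | skolem c => rfl
  | neg t ih => simp [GTerm.evalFrac, GTerm.eval, Frac.val_neg, ih]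
  | add t u ih₁ ih₂ => simp [GTerm.evalFrac, GTerm.eval, Frac.val_add, ih₁, ih₂]
  | sub t u ih₁ ih₂ =>
    simp [GTerm.evalFrac, GTerm.eval, Frac.val_add, Frac.val_neg, ih₁, ih₂, sub_eq_add_neg]

/-! ### Realizable order types of ground terms -/

/-- `ρ` lists the order type of the values of the first `n` ground terms, for some real values
of the Skolem constants. -/
def OrderTypeAt {K : Type*} [Field K] [LinearOrder K] (n : ℕ) (ρ : List ℕ) (σ : ℕ → K) : Prop :=
  ∀ i < n, ∀ j < n,
    ρ.getD i 0 < ρ.getD j 0 ↔ (GTerm.ofNat i).eval σ 1 < (GTerm.ofNat j).eval σ 1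

/-- `s` is a list of rational values of the Skolem constants that realize the order type `ρ`. -/
def RealizedBy (n : ℕ) (ρ : List ℕ) (s : List Frac) : Prop :=
  ∀ i < n, ∀ j < n, ρ.getD i 0 < ρ.getD j 0 ↔
    ((GTerm.ofNat i).evalFrac s).LT ((GTerm.ofNat j).evalFrac s)

/-- The sum of the differences `tⱼ - tᵢ` for the pairs `(i, j)` in `W`. -/
def combination (W : List (ℕ × ℕ)) (s : List Frac) : Frac :=
  W.foldr (fun p x =>
    (((GTerm.ofNat p.2).evalFrac s).add ((GTerm.ofNat p.1).evalFrac s).neg).add x) (0, 0, 0)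

/-- The values of the Skolem constants that are all zero except for the `c`-th, which is one. -/
def unitValues (c : ℕ) : List Frac := (List.range c).map (fun _ => (0, 0, 0)) ++ [(1, 0, 0)]

/-- `W` is a certificate for the order type `ρ` not being realizable: a sum of differences
`tⱼ - tᵢ` with `ρᵢ ≤ ρⱼ` which is constant, and negative, or zero with some `ρᵢ < ρⱼ`. -/
def RefutedBy (n : ℕ) (ρ : List ℕ) (W : List (ℕ × ℕ)) : Prop :=
  (∀ p ∈ W, p.1 < n ∧ p.2 < n ∧ ρ.getD p.1 0 ≤ ρ.getD p.2 0) ∧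
  (∀ c < n, ¬ (combination W (unitValues c)).LT (combination W []) ∧
    ¬ (combination W []).LT (combination W (unitValues c))) ∧
  ((combination W []).LT (0, 0, 0) ∨
    (¬ Frac.LT (0, 0, 0) (combination W []) ∧ ∃ p ∈ W, ρ.getD p.1 0 < ρ.getD p.2 0))

theorem RealizedBy.orderTypeAt {n : ℕ} {ρ : List ℕ} {s : List Frac} (h : RealizedBy n ρ s) :
    ∃ σ : ℕ → ℝ, OrderTypeAt n ρ σ := by
  refine ⟨fun c => ((s.getD c (0, 0, 0)).val : ℝ), fun i hi j hj => (h i hi j hj).trans ?_⟩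
  rw [Frac.lt_iff, GTerm.val_evalFrac, GTerm.val_evalFrac, ← Rat.cast_lt (K := ℝ),
    GTerm.eval_cast, GTerm.eval_cast, Rat.cast_one]

theorem val_combination (W : List (ℕ × ℕ)) (s : List Frac) :
    (combination W s).val = (W.map fun p =>
      (GTerm.ofNat p.2).eval (fun c => (s.getD c (0, 0, 0)).val) 1 -
      (GTerm.ofNat p.1).eval (fun c => (s.getD c (0, 0, 0)).val) 1).sum := by
  induction W with
  | nil => simp [combination, Frac.val_zero]
  | cons p W ih =>
    simp only [combination, List.foldr_cons, Frac.val_add, Frac.val_neg, GTerm.val_evalFrac,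
      List.map_cons, List.sum_cons] at ih ⊢
    rw [ih, sub_eq_add_neg]

theorem getD_unitValues (c d : ℕ) :
    ((unitValues c).getD d (0, 0, 0)).val = if d = c then 1 else 0 := by
  unfold unitValues
  rcases lt_trichotomy d c with h | h | h
  · rw [List.getD_append _ _ _ _ (by simpa using h)]
    simp [List.getD, h, h.ne, Frac.val]
  · subst h
    rw [List.getD_append_right _ _ _ _ (by simp)]
    simp [Frac.val]
  · rw [List.getD_append_right _ _ _ _ (by simp; omega), List.getD_eq_default _ _ (by simp; omega)]
    simp [h.ne', Frac.val]

/-- An affine function is determined by its values at the origin and at the unit vectors. This is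
why `RefutedBy` can test constancy at finitely many points. -/
theorem GTerm.eval_eq_sum (t : GTerm) {n : ℕ} (ht : t.toNat < n) (σ : ℕ → ℝ) :
    t.eval σ 1 = t.eval (fun _ => (0 : ℝ)) 1 + ∑ c ∈ Finset.range n,
      σ c * (t.eval (fun d => if d = c then 1 else 0) 1 - t.eval (fun _ => (0 : ℝ)) 1) := by
  induction t with
  | rat q d => simp [GTerm.eval]
  | skolem c =>
    have hc : c < n := by simp only [GTerm.toNat] at ht; omega
    simp [GTerm.eval, hc]
  | neg s ih =>
    simp only [GTerm.eval]
    rw [ih (by simp only [GTerm.toNat] at ht; omega), neg_add, ← Finset.sum_neg_distrib]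
    congr 1
    exact Finset.sum_congr rfl fun c _ => by ring
  | add s t ih₁ ih₂ =>
    have h₁ := Nat.left_le_pair s.toNat t.toNat
    have h₂ := Nat.right_le_pair s.toNat t.toNat
    simp only [GTerm.toNat] at ht
    simp only [GTerm.eval]
    rw [ih₁ (by omega), ih₂ (by omega), add_add_add_comm, ← Finset.sum_add_distrib]
    congr 1
    exact Finset.sum_congr rfl fun c _ => by ring
  | sub s t ih₁ ih₂ =>
    have h₁ := Nat.left_le_pair s.toNat t.toNat
    have h₂ := Nat.right_le_pair s.toNat t.toNat
    simp only [GTerm.toNat] at ht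
    simp only [GTerm.eval]
    rw [ih₁ (by omega), ih₂ (by omega), add_sub_add_comm, ← Finset.sum_sub_distrib]
    congr 1
    exact Finset.sum_congr rfl fun c _ => by ring

theorem sum_eq_of_constant {n : ℕ} (W : List (ℕ × ℕ)) (hW : ∀ p ∈ W, p.1 < n ∧ p.2 < n)
    (σ : ℕ → ℝ)
    (H : ∀ c < n, (W.map fun p => (GTerm.ofNat p.2).eval (fun d => if d = c then (1 : ℝ) else 0) 1 -
        (GTerm.ofNat p.1).eval (fun d => if d = c then (1 : ℝ) else 0) 1).sum =
      (W.map fun p => (GTerm.ofNat p.2).eval (fun _ => (0 : ℝ)) 1 -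
        (GTerm.ofNat p.1).eval (fun _ => (0 : ℝ)) 1).sum) :
    (W.map fun p => (GTerm.ofNat p.2).eval σ 1 - (GTerm.ofNat p.1).eval σ 1).sum =
      (W.map fun p => (GTerm.ofNat p.2).eval (fun _ => (0 : ℝ)) 1 -
        (GTerm.ofNat p.1).eval (fun _ => (0 : ℝ)) 1).sum := by
  have key : (W.map fun p => (GTerm.ofNat p.2).eval σ 1 - (GTerm.ofNat p.1).eval σ 1).sum =
      (W.map fun p => (GTerm.ofNat p.2).eval (fun _ => (0 : ℝ)) 1 -
        (GTerm.ofNat p.1).eval (fun _ => (0 : ℝ)) 1).sum + ∑ c ∈ Finset.range n, σ c *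
      ((W.map fun p => (GTerm.ofNat p.2).eval (fun d => if d = c then (1 : ℝ) else 0) 1 -
        (GTerm.ofNat p.1).eval (fun d => if d = c then (1 : ℝ) else 0) 1).sum -
      (W.map fun p => (GTerm.ofNat p.2).eval (fun _ => (0 : ℝ)) 1 -
        (GTerm.ofNat p.1).eval (fun _ => (0 : ℝ)) 1).sum) := by
    clear H
    induction W with
    | nil => simp
    | cons p W ih =>
      have hp := hW p (by simp)
      simp only [List.map_cons, List.sum_cons]
      rw [ih fun q hq => hW q (by simp [hq]),
        GTerm.eval_eq_sum (GTerm.ofNat p.2) (by rw [GTerm.toNat_ofNat]; exact hp.2) σ,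
        GTerm.eval_eq_sum (GTerm.ofNat p.1) (by rw [GTerm.toNat_ofNat]; exact hp.1) σ]
      rw [add_sub_add_comm, ← Finset.sum_sub_distrib, add_add_add_comm, ← Finset.sum_add_distrib]
      congr 1
      exact Finset.sum_congr rfl fun c _ => by ring
  rw [key, Finset.sum_eq_zero, add_zero]
  intro c hc
  rw [H c (Finset.mem_range.1 hc), sub_self, mul_zero]

theorem cast_val_combination (W : List (ℕ × ℕ)) (s : List Frac) :
    ((combination W s).val : ℝ) = (W.map fun p =>
      (GTerm.ofNat p.2).eval (fun c => ((s.getD c (0, 0, 0)).val : ℝ)) 1 -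
      (GTerm.ofNat p.1).eval (fun c => ((s.getD c (0, 0, 0)).val : ℝ)) 1).sum := by
  rw [val_combination]
  induction W with
  | nil => simp
  | cons p W ih =>
    simp only [List.map_cons, List.sum_cons, Rat.cast_add, Rat.cast_sub, GTerm.eval_cast,
      Rat.cast_one, ih]

/-- If `σ` realized `ρ`, every summand would be nonnegative at `σ`, and positive for a strict pair;
but the sum is constant, so its sign is the one found at the origin. -/
theorem RefutedBy.not_orderTypeAt {n : ℕ} {ρ : List ℕ} {W : List (ℕ × ℕ)}
    (h : RefutedBy n ρ W) (σ : ℕ → ℝ) : ¬ OrderTypeAt n ρ σ := by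
  intro hσ
  obtain ⟨hW, hc, hs⟩ := h
  have hle : ∀ p ∈ W, (0 : ℝ) ≤ (GTerm.ofNat p.2).eval σ 1 - (GTerm.ofNat p.1).eval σ 1 := by
    intro p hp
    obtain ⟨h1, h2, h3⟩ := hW p hp
    rw [sub_nonneg]
    exact not_lt.1 fun hlt => absurd ((hσ _ h2 _ h1).2 hlt) (not_lt.2 h3)
  have h0 : ((combination W []).val : ℝ) =
      (W.map fun p => (GTerm.ofNat p.2).eval (fun _ => (0 : ℝ)) 1 -
        (GTerm.ofNat p.1).eval (fun _ => (0 : ℝ)) 1).sum := by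
    rw [cast_val_combination]
    simp [Frac.val_zero]
  have hsum : (W.map fun p => (GTerm.ofNat p.2).eval σ 1 - (GTerm.ofNat p.1).eval σ 1).sum =
      ((combination W []).val : ℝ) := by
    rw [h0]
    refine sum_eq_of_constant W (fun p hp => ⟨(hW p hp).1, (hW p hp).2.1⟩) σ fun c hcn => ?_
    rw [← h0]
    obtain ⟨h1, h2⟩ := hc c hcn
    rw [Frac.lt_iff, not_lt] at h1 h2
    rw [le_antisymm h1 h2, cast_val_combination]
    simp only [getD_unitValues, apply_ite (Rat.cast : ℚ → ℝ), Rat.cast_one, Rat.cast_zero]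
  have hnonneg : (0 : ℝ) ≤ ((combination W []).val : ℝ) := by
    rw [← hsum]
    refine List.sum_nonneg ?_
    simpa using fun a p q hp ha => ha ▸ hle (p, q) hp
  rcases hs with hs | ⟨hs, p, hp, hlt⟩
  · rw [Frac.lt_iff, Frac.val_zero] at hs
    exact absurd hnonneg (not_le.2 (by exact_mod_cast hs))
  · rw [Frac.lt_iff, Frac.val_zero, not_lt] at hs
    have hpos : (0 : ℝ) < (GTerm.ofNat p.2).eval σ 1 - (GTerm.ofNat p.1).eval σ 1 :=
      sub_pos.2 ((hσ _ (hW p hp).1 _ (hW p hp).2.1).1 hlt)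
    have : (GTerm.ofNat p.2).eval σ 1 - (GTerm.ofNat p.1).eval σ 1 ≤
        (W.map fun p => (GTerm.ofNat p.2).eval σ 1 - (GTerm.ofNat p.1).eval σ 1).sum := by
      refine List.single_le_sum ?_ _ (List.mem_map.2 ⟨p, hp, rfl⟩)
      simpa using fun a p q hp ha => ha ▸ hle (p, q) hp
    rw [hsum] at this
    have h2 : ((combination W []).val : ℝ) ≤ 0 := by exact_mod_cast hs
    linarith

/-! ### Farkas' lemma for order types -/

/-- Gordan's theorem: finitely many linear forms have a common point of positivity, unless some
nontrivial combination of them with nonnegative coefficients vanishes. -/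
theorem exists_pos_or_combination_eq_zero {K ι : Type*} [Field K] [LinearOrder K]
    [IsStrictOrderedRing K] (s : Finset ι) : ∀ {V : Type u} [AddCommGroup V] [Module K V]
    (f : ι → V →ₗ[K] K), (∃ v, ∀ i ∈ s, 0 < f i v) ∨
      ∃ w : ι → K, (∀ i ∈ s, 0 ≤ w i) ∧ (∃ i ∈ s, 0 < w i) ∧ ∀ v, ∑ i ∈ s, w i * f i v = 0 := by
  classical
  induction s using Finset.induction_on with
  | empty => exact fun _ => .inl ⟨0, by simp⟩
  | insert j s hj ih =>
    intro V _ _ f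
    have hne : ∀ i ∈ s, i ≠ j := fun i hi h => hj (h ▸ hi)
    by_cases hz : f j = 0
    · refine .inr ⟨fun i => if i = j then 1 else 0, fun i _ => ?_, ⟨j, by simp, by simp⟩,
        fun v => ?_⟩
      · beta_reduce
        split_ifs <;> simp
      · refine Finset.sum_eq_zero fun i _ => ?_
        by_cases h : i = j
        · simp [h, hz]
        · simp [h]
    obtain ⟨u, hu⟩ : ∃ u, f j u = 1 := by
      obtain ⟨x, hx⟩ : ∃ x, f j x ≠ 0 := by
        by_contra! h
        exact hz (LinearMap.ext h)
      exact ⟨(f j x)⁻¹ • x, by simp [hx]⟩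
    -- Restrict to the hyperplane `f j = 0`. A positive point there is scaled up until adding `u`
    -- keeps the other forms positive; otherwise the combination that vanishes there is a multiple
    -- of `f j` on the whole space.
    rcases ih (fun i => f i ∘ₗ (LinearMap.ker (f j)).subtype) with ⟨v, hv⟩ | ⟨w, hw, hp, hsum⟩
    · left
      obtain ⟨M, hM⟩ := (s.image fun i => -f i u / f i v).exists_le
      refine ⟨(M + 1) • (v : V) + u, fun i hi => ?_⟩
      rcases Finset.mem_insert.1 hi with rfl | hi
      · have : f i v = 0 := v.2
        simp [this, hu]
      · have h1 : 0 < f i v := hv i hi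
        have h2 : -f i u / f i v ≤ M := hM _ (Finset.mem_image_of_mem _ hi)
        rw [div_le_iff₀ h1] at h2
        simp only [map_add, map_smul, smul_eq_mul]
        linarith
    · have hF : ∀ v, ∑ i ∈ s, w i * f i v = (∑ i ∈ s, w i * f i u) * f j v := by
        intro v
        have h := hsum ⟨v - f j v • u, by simp [hu]⟩
        simp only [LinearMap.comp_apply, Submodule.subtype_apply, map_sub, map_smul,
          smul_eq_mul] at h
        rw [← sub_eq_zero, ← h, Finset.sum_mul, ← Finset.sum_sub_distrib]
        exact Finset.sum_congr rfl fun i _ => by ring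
      -- A nonpositive factor can be moved to the other side as a nonnegative coefficient of `f j`.
      -- With a positive factor, any common point of positivity of the other forms also makes `f j`
      -- positive.
      rcases le_or_gt (∑ i ∈ s, w i * f i u) 0 with hc | hc
      · right
        refine ⟨fun i => if i = j then -∑ i ∈ s, w i * f i u else w i, fun i hi => ?_, ?_,
          fun v => ?_⟩
        · by_cases h : i = j
          · simpa [h] using hc
          · simpa [h] using hw i ((Finset.mem_insert.1 hi).resolve_left h)
        · obtain ⟨i, hi, hpi⟩ := hp
          exact ⟨i, Finset.mem_insert_of_mem hi, by simpa [hne i hi] using hpi⟩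
        · beta_reduce
          rw [Finset.sum_insert hj, if_pos rfl, neg_mul, ← hF v, neg_add_eq_zero]
          exact Finset.sum_congr rfl fun i hi => by rw [if_neg (hne i hi)]
      · rcases ih f with ⟨v, hv⟩ | ⟨w', hw', ⟨i, hi, hpi⟩, hsum'⟩
        · refine .inl ⟨v, fun i hi => ?_⟩
          rcases Finset.mem_insert.1 hi with rfl | hi
          · obtain ⟨k, hk, hpk⟩ := hp
            have : 0 < ∑ i ∈ s, w i * f i v :=
              Finset.sum_pos' (fun i hi => mul_nonneg (hw i hi) (hv i hi).le)
                ⟨k, hk, mul_pos hpk (hv k hk)⟩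
            rw [hF v] at this
            exact (mul_pos_iff_of_pos_left hc).1 this
          · exact hv i hi
        · refine .inr ⟨fun i => if i = j then 0 else w' i, fun k hk => ?_, ⟨i, by simp [hi], ?_⟩,
            fun v => ?_⟩
          · by_cases h : k = j
            · simp [h]
            · simpa [h] using hw' k ((Finset.mem_insert.1 hk).resolve_left h)
          · simpa [hne i hi] using hpi
          · beta_reduce
            rw [Finset.sum_insert hj, if_pos rfl, zero_mul, zero_add, ← hsum' v]
            exact Finset.sum_congr rfl fun i hi => by rw [if_neg (hne i hi)]

/-- The linear form of the difference `tⱼ - tᵢ`. -/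
def diffForm (p : ℕ × ℕ) : (ℕ → ℚ) × ℚ →ₗ[ℚ] ℚ :=
  (GTerm.ofNat p.2).form - (GTerm.ofNat p.1).form

theorem diffForm_swap (p : ℕ × ℕ) : diffForm p.swap = -diffForm p := by
  simp [diffForm]

/-- A multiple of `F` is a sum of differences `tⱼ - tᵢ` with `ρᵢ ≤ ρⱼ`, some of them strict
provided that `b` holds. -/
def IsCombination (n : ℕ) (ρ : List ℕ) (b : Prop) (F : (ℕ → ℚ) × ℚ →ₗ[ℚ] ℚ) : Prop :=
  ∃ N : ℕ, 0 < N ∧ ∃ W : List (ℕ × ℕ),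
    (∀ p ∈ W, p.1 < n ∧ p.2 < n ∧ ρ.getD p.1 0 ≤ ρ.getD p.2 0) ∧
    (b → ∃ p ∈ W, ρ.getD p.1 0 < ρ.getD p.2 0) ∧ (N : ℚ) • F = (W.map diffForm).sum

namespace IsCombination

variable {n : ℕ} {ρ : List ℕ} {b c : Prop} {F G : (ℕ → ℚ) × ℚ →ₗ[ℚ] ℚ}

theorem zero : IsCombination n ρ False 0 := ⟨1, one_pos, [], by simp⟩

theorem mono (h : IsCombination n ρ b F) (hc : c → b) : IsCombination n ρ c F := by
  obtain ⟨N, hN, W, hW, hs, he⟩ := h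
  exact ⟨N, hN, W, hW, fun h => hs (hc h), he⟩

theorem of_le {p : ℕ × ℕ} (h1 : p.1 < n) (h2 : p.2 < n) (h : ρ.getD p.1 0 ≤ ρ.getD p.2 0) :
    IsCombination n ρ (ρ.getD p.1 0 < ρ.getD p.2 0) (diffForm p) :=
  ⟨1, one_pos, [p], by simpa using ⟨h1, h2, h⟩, by simp, by simp⟩

theorem sum_flatten_replicate (k : ℕ) (W : List (ℕ × ℕ)) :
    ((List.replicate k W).flatten.map diffForm).sum = (k : ℚ) • (W.map diffForm).sum := by
  induction k with
  | zero => simp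
  | succ k ih =>
    rw [List.replicate_succ, List.flatten_cons, List.map_append, List.sum_append, ih]
    push_cast
    rw [add_smul, one_smul, add_comm]

/-- Multiplying by `q` multiplies `N` by the denominator and repeats `W` as often as the numerator
says; the numerator is positive, so strict pairs survive. -/
theorem smul (h : IsCombination n ρ b F) {q : ℚ} (hq : 0 < q) : IsCombination n ρ b (q • F) := by
  obtain ⟨N, hN, W, hW, hs, he⟩ := h
  have hnum : 0 < q.num := Rat.num_pos.2 hq
  obtain ⟨k, hk⟩ := Int.eq_ofNat_of_zero_le hnum.le
  have hk0 : k ≠ 0 := by rintro rfl; simp_all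
  refine ⟨N * q.den, Nat.mul_pos hN q.den_pos, (List.replicate k W).flatten, ?_, ?_, ?_⟩
  · intro p hp
    obtain ⟨l, hl, hp⟩ := List.mem_flatten.1 hp
    rw [List.mem_replicate] at hl
    exact hW p (hl.2 ▸ hp)
  · intro hb
    obtain ⟨p, hp, hlt⟩ := hs hb
    exact ⟨p, List.mem_flatten.2 ⟨W, List.mem_replicate.2 ⟨hk0, rfl⟩, hp⟩, hlt⟩
  · rw [sum_flatten_replicate, ← he, smul_smul, smul_smul]
    congr 1
    have : (q.den : ℚ) * q = k := by rw [Rat.den_mul_eq_num, hk]; simp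
    push_cast
    rw [mul_assoc, this, mul_comm]

theorem add (h : IsCombination n ρ b F) (h' : IsCombination n ρ c G) :
    IsCombination n ρ (b ∨ c) (F + G) := by
  obtain ⟨N, hN, W, hW, hs, he⟩ := h
  obtain ⟨N', hN', W', hW', hs', he'⟩ := h'
  refine ⟨N * N', Nat.mul_pos hN hN',
    (List.replicate N' W).flatten ++ (List.replicate N W').flatten, ?_, ?_, ?_⟩
  · intro p hp
    rcases List.mem_append.1 hp with hp | hp
    all_goals
      obtain ⟨l, hl, hp⟩ := List.mem_flatten.1 hp
      rw [List.mem_replicate] at hl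
    · exact hW p (hl.2 ▸ hp)
    · exact hW' p (hl.2 ▸ hp)
  · rintro (hb | hb)
    · obtain ⟨p, hp, hlt⟩ := hs hb
      exact ⟨p, List.mem_append_left _
        (List.mem_flatten.2 ⟨W, List.mem_replicate.2 ⟨hN'.ne', rfl⟩, hp⟩), hlt⟩
    · obtain ⟨p, hp, hlt⟩ := hs' hb
      exact ⟨p, List.mem_append_right _
        (List.mem_flatten.2 ⟨W', List.mem_replicate.2 ⟨hN.ne', rfl⟩, hp⟩), hlt⟩
  · rw [List.map_append, List.sum_append, sum_flatten_replicate, sum_flatten_replicate, ← he, ← he',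
      smul_smul, smul_smul, smul_add]
    push_cast
    rw [mul_comm (N' : ℚ)]

theorem sum {ι : Type*} (s : Finset ι) (b : ι → Prop) (G : ι → (ℕ → ℚ) × ℚ →ₗ[ℚ] ℚ)
    (h : ∀ i ∈ s, IsCombination n ρ (b i) (G i)) :
    IsCombination n ρ (∃ i ∈ s, b i) (∑ i ∈ s, G i) := by
  classical
  induction s using Finset.induction_on with
  | empty => exact zero.mono (by simp)
  | insert j s hj ih =>
    rw [Finset.sum_insert hj]
    exact ((h j (by simp)).add (ih fun i hi => h i (by simp [hi]))).mono (by simp)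

end IsCombination

/-- The form vanishes on all Skolem constants, so the combination takes the constant value `-(N *
w)`; when this is zero, `hb` supplies the strict pair. -/
theorem IsCombination.refutedBy {n : ℕ} {ρ : List ℕ} {b : Prop} {w : ℚ} (hw : 0 ≤ w)
    (hb : w = 0 → b) (h : IsCombination n ρ b (-(w • LinearMap.snd ℚ (ℕ → ℚ) ℚ))) :
    ∃ W, RefutedBy n ρ W := by
  obtain ⟨N, hN, W, hW, hs, he⟩ := h
  have hval : ∀ s, (combination W s).val = -(N * w) := by
    intro s
    have := LinearMap.congr_fun he (fun c => (s.getD c (0, 0, 0)).val, 1)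
    rw [val_combination]
    simp only [LinearMap.smul_apply, LinearMap.neg_apply, LinearMap.snd_apply, smul_eq_mul,
      mul_one, mul_neg] at this
    rw [this]
    clear * -
    induction W with
    | nil => simp
    | cons p W ih =>
      simp only [List.map_cons, List.sum_cons, LinearMap.add_apply]
      rw [← ih]
      simp [diffForm, GTerm.form_apply]
  have hN' : (0 : ℚ) < N := Nat.cast_pos.2 hN
  refine ⟨W, hW, fun c _ => ?_, ?_⟩
  · simp [Frac.lt_iff, hval]
  · simp only [Frac.lt_iff, hval, Frac.val_zero]
    rcases hw.eq_or_lt with h0 | h0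
    · right
      exact ⟨by simp [← h0], hs (hb h0.symm)⟩
    · left
      simpa using mul_pos hN' h0

/-- Gordan's theorem is applied to the strict differences together with the unit form, on the
subspace `U` where differences of terms of equal rank vanish. A combination vanishing on `U` lies in
the span of those equality forms. Their coefficients may have either sign, since the reversed pair
is admissible too. -/
theorem exists_realizedBy_or_exists_refutedBy (n : ℕ) (ρ : List ℕ) :
    (∃ s, RealizedBy n ρ s) ∨ ∃ W, RefutedBy n ρ W := by
  classical
  let S := {p : Fin n × Fin n // ρ.getD p.1 0 < ρ.getD p.2 0}
  let E := {p : Fin n × Fin n // ρ.getD p.1 0 = ρ.getD p.2 0}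
  let d : Fin n × Fin n → (ℕ → ℚ) × ℚ →ₗ[ℚ] ℚ := fun p => diffForm (p.1, p.2)
  -- `none` stands for the homogenizing coordinate, which has to be positive.
  let f : Option S → (ℕ → ℚ) × ℚ →ₗ[ℚ] ℚ := fun o => o.elim (LinearMap.snd ℚ _ ℚ) fun p => d p.1
  let U : Submodule ℚ ((ℕ → ℚ) × ℚ) := ⨅ e : E, LinearMap.ker (d e.1)
  rcases exists_pos_or_combination_eq_zero Finset.univ (fun i => f i ∘ₗ U.subtype) with
    ⟨⟨⟨σ, h⟩, hU⟩, hv⟩ | ⟨w, hw, ⟨i, -, hi⟩, hsum⟩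
  · left
    have hh : 0 < h := by simpa [f] using hv none (Finset.mem_univ _)
    choose x hx using fun c => Frac.exists_val (h⁻¹ * σ c)
    have heval : ∀ i < n, ((GTerm.ofNat i).evalFrac ((List.range n).map x)).val =
        h⁻¹ * (GTerm.ofNat i).form (σ, h) := by
      intro i hi
      rw [GTerm.val_evalFrac, GTerm.form_apply, ← GTerm.eval_smul, inv_mul_cancel₀ hh.ne']
      refine GTerm.eval_congr _ _ fun c hc => ?_
      rw [GTerm.toNat_ofNat] at hc
      rw [← hx]
      simp [List.getD, hc.trans hi]
    have hlt : ∀ i (hi : i < n) j (hj : j < n), ρ.getD i 0 < ρ.getD j 0 →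
        (GTerm.ofNat i).form (σ, h) < (GTerm.ofNat j).form (σ, h) := by
      intro i hi j hj hij
      have := hv (some ⟨(⟨i, hi⟩, ⟨j, hj⟩), hij⟩) (Finset.mem_univ _)
      simpa [f, d, diffForm] using this
    have heq : ∀ i (hi : i < n) j (hj : j < n), ρ.getD i 0 = ρ.getD j 0 →
        (GTerm.ofNat i).form (σ, h) = (GTerm.ofNat j).form (σ, h) := by
      intro i hi j hj hij
      have := (Submodule.mem_iInf _).1 hU ⟨(⟨i, hi⟩, ⟨j, hj⟩), hij⟩
      simp only [d, diffForm, LinearMap.mem_ker, LinearMap.sub_apply, sub_eq_zero] at this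
      exact this.symm
    refine ⟨(List.range n).map x, fun i hi j hj => ?_⟩
    rw [Frac.lt_iff, heval i hi, heval j hj, mul_lt_mul_iff_right₀ (inv_pos.2 hh)]
    refine ⟨hlt i hi j hj, fun hlt' => ?_⟩
    by_contra hn
    rcases (not_lt.1 hn).eq_or_lt with h' | h'
    · exact hlt'.ne (heq _ hj _ hi h').symm
    · exact hlt'.not_gt (hlt j hj i hi h')
  · right
    have hker : U ≤ LinearMap.ker (∑ i, w i • f i) := by
      intro v hv
      simpa using hsum ⟨v, hv⟩
    obtain ⟨c, hc⟩ := (Submodule.mem_span_range_iff_exists_fun ℚ).1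
      (mem_span_of_iInf_ker_le_ker hker)
    rw [Fintype.sum_option] at hc
    have hS : IsCombination n ρ (∃ p ∈ Finset.univ, 0 < w (some p))
        (∑ p : S, w (some p) • f (some p)) := by
      refine IsCombination.sum _ _ _ fun p _ => ?_
      rcases (hw (some p) (Finset.mem_univ _)).eq_or_lt with h | h
      · rw [← h, zero_smul]
        exact IsCombination.zero.mono (lt_irrefl _)
      · exact ((IsCombination.of_le (p := (↑p.1.1, ↑p.1.2)) p.1.1.2 p.1.2.2 p.2.le).smul h).mono
          fun _ => p.2
    have hE : IsCombination n ρ False (∑ e : E, (-c e) • d e.1) := by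
      refine (IsCombination.sum _ (fun _ => False) _ fun e _ => ?_).mono False.elim
      have h₁ := IsCombination.of_le (p := (↑e.1.1, ↑e.1.2)) e.1.1.2 e.1.2.2 e.2.le
      have h₂ := IsCombination.of_le (p := (↑e.1.2, ↑e.1.1)) e.1.2.2 e.1.1.2 e.2.ge
      rcases lt_trichotomy (c e) 0 with h | h | h
      · exact (h₁.smul (neg_pos.2 h)).mono False.elim
      · rw [h, neg_zero, zero_smul]
        exact IsCombination.zero
      · have := h₂.smul h
        rw [show ((↑e.1.2, ↑e.1.1) : ℕ × ℕ) = Prod.swap (↑e.1.1, ↑e.1.2) from rfl,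
          diffForm_swap, smul_neg, ← neg_smul] at this
        exact this.mono False.elim
    have hkey : (∑ p : S, w (some p) • f (some p)) + ∑ e : E, (-c e) • d e.1 =
        -(w none • LinearMap.snd ℚ (ℕ → ℚ) ℚ) := by
      simp only [neg_smul, Finset.sum_neg_distrib]
      rw [hc]
      simp only [f, Option.elim]
      abel
    have := hS.add hE
    rw [hkey] at this
    refine this.refutedBy (hw none (Finset.mem_univ _)) fun h0 => .inl ?_
    -- If the unit form has coefficient zero, the positive coefficient belongs to a strict pair.
    cases i with
    | none => exact absurd h0 hi.ne'
    | some p => exact ⟨p, Finset.mem_univ _, hi⟩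

/-! ### Ramsey's theorem -/

open Filter in
/-- The iterated quantifier `∀ᶠ x₁, …, ∀ᶠ xₖ` with respect to a nonprincipal ultrafilter. -/
def Almost : ℕ → (List ℕ → Prop) → Prop
  | 0, φ => φ []
  | k + 1, φ => ∀ᶠ x in (hyperfilter ℕ : Filter ℕ), Almost k fun s => φ (x :: s)

/-- Elements are added to `H` one at a time. The invariant is that replacing generic elements by
actual ones from `H` does not change truth, so that truth on `H` depends on the length of the tuple
only. -/
theorem exists_almost {ι : Type*} [Finite ι] (φ : ι → List ℕ → Prop) (m j : ℕ) (hj : j ≤ m) :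
    ∃ H : List ℕ, H.length = j ∧ H.Pairwise (· < ·) ∧ ∀ i, ∀ k, k + j ≤ m → ∀ s, s.Sublist H →
      (Almost k (fun t => φ i (s ++ t)) ↔ Almost (s.length + k) (φ i)) := by
  induction j with
  | zero =>
    refine ⟨[], rfl, List.Pairwise.nil, fun i k _ s hs => ?_⟩
    rw [List.sublist_nil] at hs
    subst hs
    simp
  | succ j ih =>
    obtain ⟨H, hlen, hH, hφ⟩ := ih (by omega)
    have h1 : ∀ᶠ x in (Filter.hyperfilter ℕ : Filter ℕ), ∀ y ∈ H.toFinset, y < x :=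
      (Filter.eventually_all_finset _).2 fun y _ =>
        (Filter.eventually_gt_atTop y).filter_mono Nat.hyperfilter_le_atTop
    have h2 : ∀ᶠ x in (Filter.hyperfilter ℕ : Filter ℕ), ∀ i, ∀ k ∈ Finset.range (m - j),
        ∀ s ∈ H.sublists.toFinset, (Almost k (fun t => φ i (s ++ (x :: t))) ↔
          Almost (s.length + (k + 1)) (φ i)) := by
      refine Filter.eventually_all.2 fun i => (Filter.eventually_all_finset _).2 fun k hk =>
        (Filter.eventually_all_finset _).2 fun s hs => ?_
      have hs' : s.Sublist H := by simpa using hs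
      have hk' := Finset.mem_range.1 hk
      have := hφ i (k + 1) (by omega) s hs'
      -- An ultrafilter decides each property, so almost every `x` agrees with the generic truth
      -- value; only finitely many such conditions are intersected.
      by_cases h : Almost (s.length + (k + 1)) (φ i)
      · exact Filter.Eventually.mono (this.2 h) fun x hx => iff_of_true hx h
      · exact Filter.Eventually.mono (Ultrafilter.eventually_not.2 fun hx => h (this.1 hx))
          fun x hx => iff_of_false hx h
    obtain ⟨x, hx1, hx2⟩ := (h1.and h2).exists
    refine ⟨H ++ [x], by simp [hlen], ?_, fun i k hk s hs => ?_⟩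
    · rw [List.pairwise_append]
      exact ⟨hH, List.pairwise_singleton _ _, by simpa using hx1⟩
    · obtain ⟨s₁, s₂, rfl, h₁, h₂⟩ := List.sublist_append_iff.1 hs
      rcases List.sublist_singleton.1 h₂ with rfl | rfl
      · rw [List.append_nil]
        exact hφ i k (by omega) s₁ h₁
      · have := hx2 i k (Finset.mem_range.2 (by omega)) s₁ (by simpa using h₁)
        simp only [List.append_assoc, List.singleton_append, List.length_append,
          List.length_singleton, this]
        rw [Nat.add_assoc, Nat.add_comm 1 k]

/-- The finite form of Ramsey's theorem, for finitely many relations on increasing tuples. -/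
theorem exists_homogeneous {ι : Type*} [Finite ι] (φ : ι → List ℕ → Prop) (m : ℕ) :
    ∃ H : List ℕ, H.length = m ∧ H.Pairwise (· < ·) ∧ ∀ i, ∀ s s', s.Sublist H → s'.Sublist H →
      s.length = s'.length → (φ i s ↔ φ i s') := by
  obtain ⟨H, hlen, hH, hφ⟩ := exists_almost φ m m le_rfl
  refine ⟨H, hlen, hH, fun i s s' hs hs' hl => ?_⟩
  have h := hφ i 0 (by omega) s hs
  have h' := hφ i 0 (by omega) s' hs'
  simp only [Almost, List.append_nil, Nat.add_zero] at h h'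
  rw [h, h', hl]

/-! ### Order types of tuples -/

/-- The relative position of two elements of a linear order. -/
def cmpCode {α : Type*} [LinearOrder α] (x y : α) : ℕ :=
  if x < y then 0 else if y < x then 1 else 2

theorem cmpCode_eq_cmpCode {α β : Type*} [LinearOrder α] [LinearOrder β] {x y : α} {x' y' : β} :
    cmpCode x y = cmpCode x' y' ↔ (x < y ↔ x' < y') ∧ (y < x ↔ y' < x') := by
  rcases lt_trichotomy x y with h | h | h <;> rcases lt_trichotomy x' y' with h' | h' | h' <;>
    simp [cmpCode, h, h', h.not_gt, h'.not_gt]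

/-- The order type of a tuple over two sorts relative to the elements `cuts` of the first sort. -/
def tupleType {α γ : Type*} [LinearOrder α] (cuts : List α) (l : List (α ⊕ γ)) :
    List ((List ℕ × List ℕ) ⊕ γ) :=
  -- The code 3 marks a comparison with a free-sort entry; `cmpCode` takes only the values 0, 1, 2.
  l.map (Sum.map (fun x => (cuts.map (cmpCode x), l.map (Sum.elim (cmpCode x) fun _ => 3))) id)

/-- Maps that preserve the order among the entries and the cuts preserve the types of tuples. -/
theorem tupleType_map_eq {α β γ ι κ : Type*} [LinearOrder α] [LinearOrder β] (I : List κ)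
    (v : κ → α) (v' : κ → β) (l : List ι) (f : ι → α ⊕ γ) (f' : ι → β ⊕ γ)
    (hf : ∀ a ∈ l, (∃ x y, f a = Sum.inl x ∧ f' a = Sum.inl y ∧
      ∀ i ∈ I, cmpCode x (v i) = cmpCode y (v' i)) ∨ ∃ c, f a = Sum.inr c ∧ f' a = Sum.inr c)
    (hff : ∀ a ∈ l, ∀ b ∈ l, ∀ x y x' y', f a = Sum.inl x → f b = Sum.inl y → f' a = Sum.inl x' →
      f' b = Sum.inl y' → cmpCode x y = cmpCode x' y') :
    tupleType (I.map v) (l.map f) = tupleType (I.map v') (l.map f') := by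
  unfold tupleType
  rw [List.map_map, List.map_map]
  refine List.map_congr_left fun a ha => ?_
  rcases hf a ha with ⟨x, x', hx, hx', hI⟩ | ⟨c, hc, hc'⟩
  · simp only [Function.comp_apply, hx, hx', Sum.map_inl, Sum.inl.injEq, Prod.mk.injEq,
      List.map_map]
    refine ⟨List.map_congr_left hI, List.map_congr_left fun b hb => ?_⟩
    rcases hf b hb with ⟨y, y', hy, hy', -⟩ | ⟨c, hc, hc'⟩
    · simpa [hy, hy'] using hff a ha b hb _ _ _ _ hx hy hx' hy'
    · simp [hc, hc']
  · simp [hc, hc']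

/-- Tuples of the same type arise from each other by an order isomorphism. -/
theorem exists_map_of_tupleType_eq {α γ : Type*} [LinearOrder α] [Inhabited α] {cuts : List α}
    {l l' : List (α ⊕ γ)} (h : tupleType cuts l = tupleType cuts l') :
    ∃ g : α → α, l' = l.map (Sum.map g id) ∧
      (∀ p, Sum.inl p ∈ l → ∀ c ∈ cuts, cmpCode p c = cmpCode (g p) c) ∧
      ∀ p q, Sum.inl p ∈ l → Sum.inl q ∈ l → p < q → g p < g q := by
  have hk : ∀ k : ℕ, (∃ p p', l[k]? = some (Sum.inl p) ∧ l'[k]? = some (Sum.inl p') ∧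
      cuts.map (cmpCode p) = cuts.map (cmpCode p') ∧
      l.map (Sum.elim (cmpCode p) fun _ => 3) = l'.map (Sum.elim (cmpCode p') fun _ => 3)) ∨
      (∃ c, l[k]? = some (Sum.inr c) ∧ l'[k]? = some (Sum.inr c)) ∨ (l[k]? = none ∧ l'[k]? = none) := by
    intro k
    have := congrArg (fun l => l[k]?) h
    simp only [tupleType, List.getElem?_map] at this
    rcases hl : l[k]? with _ | (p | c) <;> rcases hl' : l'[k]? with _ | (p' | c') <;>
      simp_all
  have hT : ∀ (j k : ℕ) p p' q q', l[j]? = some (Sum.inl p) → l'[j]? = some (Sum.inl p') →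
      l[k]? = some (Sum.inl q) → l'[k]? = some (Sum.inl q') → cmpCode p q = cmpCode p' q' := by
    intro j k p p' q q' h1 h2 h3 h4
    rcases hk j with ⟨r, r', h5, h6, -, h7⟩ | ⟨c, h5, h6⟩ | ⟨h5, h6⟩
    · rw [h1] at h5; rw [h2] at h6
      simp only [Option.some.injEq, Sum.inl.injEq] at h5 h6
      subst h5 h6
      have := congrArg (fun l => l[k]?) h7
      simpa [h3, h4] using this
    · simp [h1] at h5
    · simp [h1] at h5
  -- The type records all comparisons, so equal entries of `l` face equal entries of `l'` and the
  -- image of `p` does not depend on the position; points not in `l` get a default value.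
  have hex : ∀ p, ∃ p', ∀ k : ℕ, l[k]? = some (Sum.inl p) → l'[k]? = some (Sum.inl p') := by
    intro p
    by_cases hp : ∃ j : ℕ, l[j]? = some (Sum.inl p)
    · obtain ⟨j, hj⟩ := hp
      rcases hk j with ⟨r, r', h5, h6, -⟩ | ⟨c, h5, h6⟩ | ⟨h5, h6⟩
      · rw [hj] at h5
        simp only [Option.some.injEq, Sum.inl.injEq] at h5
        subst h5
        refine ⟨r', fun k hk' => ?_⟩
        rcases hk k with ⟨q, q', h7, h8, -⟩ | ⟨c, h7, h8⟩ | ⟨h7, h8⟩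
        · rw [hk'] at h7
          simp only [Option.some.injEq, Sum.inl.injEq] at h7
          subst h7
          have := cmpCode_eq_cmpCode.1 (hT j k _ _ _ _ hj h6 hk' h8)
          simp only [lt_self_iff_false, false_iff, not_lt] at this
          rw [h8, le_antisymm this.1 this.2]
        · simp [hk'] at h7
        · simp [hk'] at h7
      · simp [hj] at h5
      · simp [hj] at h5
    · exact ⟨default, fun k hk' => absurd ⟨k, hk'⟩ hp⟩
  choose g hg using hex
  refine ⟨g, List.ext_getElem? fun k => ?_, fun p hp c hc => ?_, fun p q hp hq hpq => ?_⟩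
  · rw [List.getElem?_map]
    rcases hk k with ⟨q, q', h7, h8, -⟩ | ⟨c, h7, h8⟩ | ⟨h7, h8⟩
    · rw [hg q k h7, h7]; rfl
    · rw [h7, h8]; rfl
    · rw [h7, h8]; rfl
  · obtain ⟨k, hk'⟩ := List.mem_iff_getElem?.1 hp
    rcases hk k with ⟨q, q', h7, h8, h9, -⟩ | ⟨c, h7, h8⟩ | ⟨h7, h8⟩
    · rw [hk'] at h7
      rw [hg p k hk'] at h8
      simp only [Option.some.injEq, Sum.inl.injEq] at h7 h8
      subst h7 h8
      exact List.map_inj_left.1 h9 c hc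
    · simp [hk'] at h7
    · simp [hk'] at h7
  · obtain ⟨j, hj⟩ := List.mem_iff_getElem?.1 hp
    obtain ⟨k, hk'⟩ := List.mem_iff_getElem?.1 hq
    exact (cmpCode_eq_cmpCode.1 (hT j k _ _ _ _ hj (hg p j hj) hk' (hg q k hk'))).1.1 hpq

/-! ### Uniform points -/

/-- Strictly increasing sequences of reals in the gaps between the cuts `v i`. -/
theorem exists_sequences (n : ℕ) (κ : ℕ → ℕ) (v : ℕ → ℝ)
    (hκ : ∀ i < n, ∀ j < n, κ i < κ j ↔ v i < v j) :
    ∃ h : ℕ → ℕ → ℝ, (∀ p k, ∀ i < n, cmpCode p (κ i) = cmpCode (h p k) (v i)) ∧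
      (∀ p, (∀ i < n, κ i ≠ p) → StrictMono (h p)) ∧
      ∀ p q, (∀ i < n, cmpCode p (κ i) = cmpCode q (κ i)) → h p = h q := by
  have hF : ∀ p, ∃ f : ℕ → ℝ, (∀ k, ∀ i < n, cmpCode p (κ i) = cmpCode (f k) (v i)) ∧
      ((∀ i < n, κ i ≠ p) → StrictMono f) := by
    intro p
    by_cases hp : ∃ i < n, κ i = p
    · obtain ⟨i, hi, rfl⟩ := hp
      -- A point lying on a cut has no room to move, so its sequence is constant.
      exact ⟨fun _ => v i, fun _ j hj => cmpCode_eq_cmpCode.2 ⟨hκ i hi j hj, hκ j hj i hi⟩,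
        fun h => absurd rfl (h i hi)⟩
    · push Not at hp
      let lo : Finset ℝ := ((Finset.range n).filter (κ · < p)).image v
      let hi : Finset ℝ := ((Finset.range n).filter (p < κ ·)).image v
      have hlohi : ∀ x ∈ lo, ∀ y ∈ hi, x < y := by
        intro x hx y hy
        simp only [lo, hi, Finset.mem_image, Finset.mem_filter, Finset.mem_range] at hx hy
        obtain ⟨i, ⟨hi, hip⟩, rfl⟩ := hx
        obtain ⟨j, ⟨hj, hjp⟩, rfl⟩ := hy
        exact (hκ i hi j hj).1 (hip.trans hjp)
      -- The open gap around `p`: a nonempty set without a largest element, so it contains an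
      -- increasing sequence.
      let G := {y : ℝ // (∀ x ∈ lo, x < y) ∧ ∀ x ∈ hi, y < x}
      have : Nonempty G := by
        obtain ⟨y, hy⟩ := Order.exists_between_finsets lo hi hlohi
        exact ⟨y, hy⟩
      have : NoMaxOrder G := by
        refine ⟨fun ⟨y, hy1, hy2⟩ => ?_⟩
        obtain ⟨y', h1, h2⟩ := Order.exists_between_finsets {y} hi (by simpa using hy2)
        have hyy : y < y' := h1 y (by simp)
        exact ⟨⟨y', fun x hx => (hy1 x hx).trans hyy, h2⟩, hyy⟩
      obtain ⟨f, hf⟩ := Nat.exists_strictMono G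
      refine ⟨fun k => f k, fun k i hin => ?_, fun _ => fun a b hab => hf hab⟩
      rcases lt_or_gt_of_ne (hp i hin) with h | h
      · have : v i < f k := (f k).2.1 _ (Finset.mem_image_of_mem _ (by simp [hin, h]))
        exact cmpCode_eq_cmpCode.2 ⟨by simp [h.not_gt, this.not_gt], by simp [h, this]⟩
      · have : (f k : ℝ) < v i := (f k).2.2 _ (Finset.mem_image_of_mem _ (by simp [hin, h]))
        exact cmpCode_eq_cmpCode.2 ⟨by simp [h, this], by simp [h.not_gt, this.not_gt]⟩
  choose F hF1 hF2 using hF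
  let c : ℕ → List ℕ := fun p => (List.range n).map fun i => cmpCode p (κ i)
  have hc : ∀ {p q}, c p = c q ↔ ∀ i < n, cmpCode p (κ i) = cmpCode q (κ i) := by
    intro p q
    simp [c, List.map_inj_left]
  -- A canonical representative of each gap, so that points in the same gap share one sequence.
  let r : ℕ → ℕ := fun p => Function.invFun c (c p)
  have hr : ∀ p, ∀ i < n, cmpCode (r p) (κ i) = cmpCode p (κ i) :=
    fun p => hc.1 (Function.invFun_eq ⟨p, rfl⟩)
  refine ⟨fun p => F (r p), fun p k i hi => ?_, fun p hp => hF2 _ fun i hi he => ?_,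
    fun p q hpq => ?_⟩
  · rw [← hr p i hi, hF1 (r p) k i hi]
  · have := cmpCode_eq_cmpCode.1 (hr p i hi)
    simp only [he, lt_self_iff_false, false_iff, not_lt] at this
    exact hp i hi (he.trans (le_antisymm this.1 this.2))
  · simp only [r]
    rw [hc.2 hpq]

/-- For finitely many relations on tuples over two sorts, there are real points in any given
arrangement relative to the cuts `v i`, such that the relations hold for a tuple of these points
depending on its type only. -/
theorem exists_uniform_points (n m : ℕ) (κ : ℕ → ℕ) (v : ℕ → ℝ)
    (hκ : ∀ i < n, ∀ j < n, κ i < κ j ↔ v i < v j) {γ D : Type*} (c : γ → D)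
    (pred : ℕ → Set (List (ℝ ⊕ D))) (L : List (ℕ × List (ℕ ⊕ γ)))
    (hL : ∀ x ∈ L, ∀ p, Sum.inl p ∈ x.2 → p < m) :
    ∃ z : ℕ → ℝ, (∀ p < m, ∀ q < m, cmpCode p q = cmpCode (z p) (z q)) ∧
      (∀ p, ∀ i < n, cmpCode p (κ i) = cmpCode (z p) (v i)) ∧
      ∀ P l l', (P, l) ∈ L → (P, l') ∈ L →
        tupleType ((List.range n).map κ) l = tupleType ((List.range n).map κ) l' →
        (l.map (Sum.map z c) ∈ pred P ↔ l'.map (Sum.map z c) ∈ pred P) := by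
  classical
  obtain ⟨h, hcut, hmono, heq⟩ := exists_sequences n κ v hκ
  let supp : List (ℕ ⊕ γ) → List ℕ := fun l => (List.range m).filter fun q => Sum.inl q ∈ l
  -- The colouring for Ramsey's theorem: `s` prescribes, for each base point of the tuple, which
  -- term of its sequence to use. The choice of `y` off the support is immaterial.
  let φ : {x // x ∈ L} → List ℕ → Prop := fun x s => ∃ y : ℕ → ℕ, (supp x.1.2).map y = s ∧
    x.1.2.map (Sum.map (fun p => h p (y p)) c) ∈ pred x.1.1
  obtain ⟨H, hlen, hH, hφ⟩ := exists_homogeneous φ m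
  let y : ℕ → ℕ := fun p => H.getD p 0
  have hHy : H = (List.range m).map y := by
    refine List.ext_getElem (by simp [hlen]) fun i h1 h2 => ?_
    simp [y, h1]
  have hsupp : ∀ x ∈ L, ∀ p, p ∈ supp x.2 ↔ Sum.inl p ∈ x.2 := by
    intro x hx p
    simpa [supp] using hL x hx p
  have hsub : ∀ l, ((supp l).map y).Sublist H := by
    intro l
    conv_rhs => rw [hHy]
    exact List.Sublist.map _ List.filter_sublist
  have hy : ∀ p < m, ∀ q < m, p < q → y p < y q := by
    intro p hp q hq hpq
    have := List.pairwise_iff_getElem.1 hH p q (by omega) (by omega) hpq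
    simpa [y, List.getD, hlen, hp, hq] using this
  have hφy : ∀ x : {x // x ∈ L}, φ x ((supp x.1.2).map y) ↔
      x.1.2.map (Sum.map (fun p => h p (y p)) c) ∈ pred x.1.1 := by
    intro x
    refine ⟨fun ⟨y', he, hy'⟩ => ?_, fun hx => ⟨y, rfl, hx⟩⟩
    convert hy' using 1
    refine List.map_congr_left fun a ha => ?_
    rcases a with p | d
    · have := List.map_inj_left.1 he p ((hsupp x.1 x.2 p).2 ha)
      simp [this]
    · rfl
  -- Tuples of equal type have the same colouring: the order isomorphism `g` between them preserves
  -- gaps, so `p` and `g p` have the same sequence.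
  have himp : ∀ P l l' (hl : (P, l) ∈ L) (hl' : (P, l') ∈ L),
      tupleType ((List.range n).map κ) l = tupleType ((List.range n).map κ) l' →
      (supp l).length = (supp l').length ∧ ∀ s, φ ⟨(P, l'), hl'⟩ s → φ ⟨(P, l), hl⟩ s := by
    intro P l l' hl hl' ht
    obtain ⟨g, rfl, hg1, hg2⟩ := exists_map_of_tupleType_eq ht
    have hs : supp (l.map (Sum.map g id)) = (supp l).map g := by
      refine List.Pairwise.eq_of_mem_iff (r := (· < ·)) (List.pairwise_lt_range.filter _) ?_ ?_
      · rw [List.pairwise_map]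
        refine List.Pairwise.imp_of_mem ?_ (List.pairwise_lt_range.filter _)
        intro p q hp hq hpq
        exact hg2 p q ((hsupp _ hl p).1 hp) ((hsupp _ hl q).1 hq) hpq
      · intro q
        rw [hsupp _ hl' q, List.mem_map, List.mem_map]
        constructor
        · rintro ⟨p | d, hp, he⟩
          · exact ⟨p, (hsupp _ hl p).2 hp, by simpa using he⟩
          · simp at he
        · rintro ⟨p, hp, rfl⟩
          exact ⟨Sum.inl p, (hsupp _ hl p).1 hp, rfl⟩
    refine ⟨by rw [hs, List.length_map], ?_⟩
    rintro s ⟨y', hy's, hy'⟩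
    refine ⟨fun p => y' (g p), ?_, ?_⟩
    · simp only at hy's ⊢
      rw [hs, List.map_map] at hy's
      exact hy's
    · simp only at hy' ⊢
      rw [List.map_map] at hy'
      convert hy' using 1
      refine List.map_congr_left fun a ha => ?_
      rcases a with p | d
      · have : h p = h (g p) := heq _ _ fun i hi =>
          hg1 p ha _ (List.mem_map_of_mem (List.mem_range.2 hi))
        simp [this]
      · rfl
  -- Within a gap, one common sequence is read at increasing indices; otherwise a cut separates the
  -- points.
  have hlt : ∀ p < m, ∀ q < m, p < q → h p (y p) < h q (y q) := by
    intro p hp q hq hpq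
    by_cases hsame : ∀ i < n, cmpCode p (κ i) = cmpCode q (κ i)
    · rw [heq p q hsame]
      refine hmono q (fun i hi he => ?_) (hy p hp q hq hpq)
      have := cmpCode_eq_cmpCode.1 (hsame i hi)
      simp only [he, lt_self_iff_false, iff_false] at this
      exact this.1 hpq
    · push Not at hsame
      obtain ⟨i, hi, hne⟩ := hsame
      have h1 := cmpCode_eq_cmpCode.1 (hcut p (y p) i hi)
      have h2 := cmpCode_eq_cmpCode.1 (hcut q (y q) i hi)
      rcases lt_trichotomy p (κ i) with h3 | h3 | h3
      · rcases lt_or_ge q (κ i) with h4 | h4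
        · exact absurd (cmpCode_eq_cmpCode.2 (by simp [h3, h4, h3.not_gt, h4.not_gt])) hne
        · exact (h1.1.1 h3).trans_le (not_lt.1 fun h5 => h4.not_gt (h2.1.2 h5))
      · exact (not_lt.1 fun h5 => h3.not_gt (h1.2.2 h5)).trans_lt (h2.2.1 (by omega))
      · have h4 : κ i < q := h3.trans hpq
        exact absurd (cmpCode_eq_cmpCode.2 (by simp [h3, h4, h3.not_gt, h4.not_gt])) hne
  refine ⟨fun p => h p (y p), fun p hp q hq => ?_, fun p i hi => hcut p (y p) i hi,
    fun P l l' hl hl' ht => ?_⟩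
  · rcases lt_trichotomy p q with hpq | rfl | hpq
    · have := hlt p hp q hq hpq
      exact cmpCode_eq_cmpCode.2 (by simp [hpq, this, hpq.not_gt, this.not_gt])
    · exact cmpCode_eq_cmpCode.2 (by simp)
    · have := hlt q hq p hp hpq
      exact cmpCode_eq_cmpCode.2 (by simp [hpq, this, hpq.not_gt, this.not_gt])
  · have h1 := himp P l l' hl hl' ht
    have h2 := himp P l' l hl' hl ht.symm
    have e1 := hφy ⟨(P, l), hl⟩
    have e2 := hφy ⟨(P, l'), hl'⟩
    rw [← e1, ← e2]
    -- Homogeneity exchanges the indices used for `l` with those used for `l'`.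
    rw [hφ ⟨(P, l), hl⟩ _ _ (hsub l) (hsub l') (by simp [h1.1])]
    exact ⟨h2.2 _, h1.2 _⟩

/-! ### Finite lists of tuples and subsets -/

/-- All lists of length `k` with entries in `a`. -/
def words {α : Type*} (a : List α) : ℕ → List (List α)
  | 0 => [[]]
  | k + 1 => (words a k).flatMap fun l => a.map (· :: l)

theorem mem_words {α : Type*} {a : List α} {k : ℕ} {l : List α} :
    l ∈ words a k ↔ l.length = k ∧ ∀ x ∈ l, x ∈ a := by
  induction k generalizing l with
  | zero =>
    simp only [words, List.mem_singleton, List.length_eq_zero_iff]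
    exact ⟨fun h => ⟨h, by simp [h]⟩, fun h => h.1⟩
  | succ k ih =>
    simp only [words, List.mem_flatMap, List.mem_map, ih]
    constructor
    · rintro ⟨t, ⟨h1, h2⟩, x, hx, rfl⟩
      exact ⟨by simp [h1], by simpa [hx] using h2⟩
    · rintro ⟨h1, h2⟩
      cases l with
      | nil => simp at h1
      | cons x t =>
        exact ⟨t, ⟨by simpa using h1, fun y hy => h2 y (by simp [hy])⟩, x, h2 x (by simp), rfl⟩

theorem getD_lt_of_mem_words {m k x : ℕ} {l : List ℕ} (hm : 0 < m)
    (h : l ∈ words (List.range m) k) : l.getD x 0 < m := by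
  rcases lt_or_ge x l.length with hx | hx
  · rw [List.getD_eq_getElem _ _ hx]
    exact List.mem_range.1 ((mem_words.1 h).2 _ (List.getElem_mem hx))
  · rwa [List.getD_eq_default _ _ hx]

theorem map_range_mem_words {m k : ℕ} {f : ℕ → ℕ} (h : ∀ i < k, f i < m) :
    (List.range k).map f ∈ words (List.range m) k := by
  rw [mem_words]
  simpa using h

theorem getD_map_range {α : Type*} {k i : ℕ} (f : ℕ → α) (d : α) (h : i < k) :
    ((List.range k).map f).getD i d = f i := by
  simp [List.getD, h]

/-- The sublists of a list. -/
def subsets {α : Type*} (l : List α) : List (List α) :=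
  l.foldr (fun x L => L ++ L.map (x :: ·)) [[]]

theorem exists_mem_subsets {α : Type*} (l : List α) (p : α → Prop) :
    ∃ V ∈ subsets l, ∀ x, x ∈ V ↔ x ∈ l ∧ p x := by
  induction l with
  | nil => exact ⟨[], by simp [subsets], by simp⟩
  | cons a l ih =>
    obtain ⟨V, hV, hp⟩ := ih
    simp only [subsets, List.foldr_cons] at hV ⊢
    by_cases ha : p a
    · refine ⟨a :: V, List.mem_append_right _ (List.mem_map_of_mem hV), fun x => ?_⟩
      rw [List.mem_cons, List.mem_cons, hp]
      constructor
      · rintro (rfl | h)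
        · exact ⟨.inl rfl, ha⟩
        · exact ⟨.inr h.1, h.2⟩
      · rintro ⟨h | h, hx⟩
        · exact .inl h
        · exact .inr ⟨h, hx⟩
    · refine ⟨V, List.mem_append_left _ hV, fun x => ?_⟩
      rw [List.mem_cons, hp]
      constructor
      · exact fun h => ⟨.inr h.1, h.2⟩
      · rintro ⟨rfl | h, hx⟩
        · exact absurd hx ha
        · exact ⟨h, hx⟩

/-! ### Evaluation of clauses on a grid of natural numbers -/

abbrev GroundType := ℕ × List ((List ℕ × List ℕ) ⊕ ℕ)

def Rel.HoldsNat : Rel → ℕ → ℕ → Prop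
  | .lt, a, b => a < b
  | .le, a, b => a ≤ b
  | .eq, a, b => a = b
  | .ne, a, b => a ≠ b
  | .ge, a, b => a ≥ b
  | .gt, a, b => a > b

/-- A ground term is evaluated to the entry of `cuts` given by its code, a variable to its entry
in `b`. -/
def Constraint.GridHolds (cuts b : List ℕ) : Constraint → Prop
  | .ground s r t => r.HoldsNat (cuts.getD s.toNat 0) (cuts.getD t.toNat 0)
  | .varTerm x r t => r.HoldsNat (b.getD x 0) (cuts.getD t.toNat 0)
  | .varVar x r y => r.HoldsNat (b.getD x 0) (b.getD y 0)

/-- The list `f` assigns to a variable the index of a constant, and `e` gives the element which that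
constant denotes; variables thus range over named elements only. -/
def FTerm.gridVal (e f : List ℕ) : FTerm → ℕ
  | .var v => e.getD (f.getD v 0) 0
  | .const c => e.getD c 0

def Arg.gridVal (e b f : List ℕ) : Arg → ℕ ⊕ ℕ
  | .base x => .inl (b.getD x 0)
  | .free s => .inr (s.gridVal e f)

/-- The truth of an atom, where `V` lists the types of the tuples for which the predicates hold. -/
def Atom.GridHolds (cuts e : List ℕ) (V : List GroundType) (b f : List ℕ) : Atom → Prop
  | .eq s t => s.gridVal e f = t.gridVal e f
  | .pred P args => (P, tupleType cuts (args.map (Arg.gridVal e b f))) ∈ V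

def Clause.GridHolds (cuts e : List ℕ) (V : List GroundType) (b f : List ℕ) (C : Clause) : Prop :=
  ((∀ a ∈ C.constraints, a.GridHolds cuts b) ∧ (∀ a ∈ C.antecedent, a.GridHolds cuts e V b f)) →
    ∃ a ∈ C.succedent, a.GridHolds cuts e V b f

/-- The cut points for the order type `ρ`, with `n` points in between any two of them. -/
def scale (n : ℕ) (ρ : List ℕ) : List ℕ := ρ.map fun c => (c + 1) * (n + 1)

/-- Ranks are below `n`, so the largest cut is at most `n * (n + 1)`; there is room for `n` points
below the first cut and above the last. -/
def gridSize (n : ℕ) : ℕ := (n + 2) * (n + 1)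

def gridArgs (n : ℕ) : List (ℕ ⊕ ℕ) :=
  (List.range (gridSize n)).map .inl ++ (List.range n).map .inr

def gridTuples (n : ℕ) : List (ℕ × List (ℕ ⊕ ℕ)) :=
  (List.range n).flatMap fun P => (List.range n).flatMap fun k =>
    (words (gridArgs n) k).map fun l => (P, l)

def gridTypes (n : ℕ) (cuts : List ℕ) : List GroundType :=
  (gridTuples n).map fun x => (x.1, tupleType cuts x.2)

def GridModel (n : ℕ) (cuts e : List ℕ) (V : List GroundType) (N : ClauseSet) : Prop :=
  ∀ C ∈ N, ∀ b ∈ words (List.range (gridSize n)) n, ∀ f ∈ words (List.range n) n,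
    C.GridHolds cuts e V b f

/-- The guess `e` says which constants coincide, the guess `V` which types satisfy which predicates;
both range over finite computable lists. -/
def GridSatisfiable (n : ℕ) (ρ : List ℕ) (N : ClauseSet) : Prop :=
  ∃ e ∈ words (List.range n) n, ∃ V ∈ subsets (gridTypes n (scale n ρ)),
    GridModel n (scale n ρ) e V N

/-! ### Bounds for the symbols in a clause set -/

def Constraint.Bounded (n : ℕ) : Constraint → Prop
  | .ground s _ t => s.toNat < n ∧ t.toNat < n
  | .varTerm x _ t => x < n ∧ t.toNat < n
  | .varVar x _ y => x < n ∧ y < n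

def FTerm.Bounded (n : ℕ) : FTerm → Prop
  | .var v => v < n
  | .const c => c < n

def Arg.Bounded (n : ℕ) : Arg → Prop
  | .base x => x < n
  | .free s => s.Bounded n

def Atom.Bounded (n : ℕ) : Atom → Prop
  | .eq s t => s.Bounded n ∧ t.Bounded n
  | .pred P args => P < n ∧ args.length < n ∧ ∀ a ∈ args, a.Bounded n

def Clause.Bounded (n : ℕ) (C : Clause) : Prop :=
  (∀ a ∈ C.constraints, a.Bounded n) ∧ (∀ a ∈ C.antecedent, a.Bounded n) ∧
    ∀ a ∈ C.succedent, a.Bounded n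

open Encodable

/-- Encodings grow along the syntax tree, so the code of a clause set bounds every index, term code
and argument list length in it. -/
theorem encode_le_encode_of_mem {α : Type*} [Encodable α] {a : α} {l : List α} (h : a ∈ l) :
    encode a < encode l := by
  induction l with
  | nil => simp at h
  | cons b l ih =>
    rw [encode_list_cons]
    rcases List.mem_cons.1 h with rfl | h
    · exact Nat.lt_succ_of_le (Nat.left_le_pair _ _)
    · exact (ih h).trans_le ((Nat.right_le_pair _ _).trans (Nat.le_succ _))

theorem length_le_encode {α : Type*} [Encodable α] (l : List α) : l.length ≤ encode l := by
  induction l with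
  | nil => simp
  | cons b l ih =>
    rw [encode_list_cons, List.length_cons]
    exact Nat.succ_le_succ (ih.trans (Nat.right_le_pair _ _))

theorem encode_le_encode_pair_left {α β : Type*} [Encodable α] [Encodable β] (a : α) (b : β) :
    encode a ≤ encode (a, b) := by
  rw [encode_prod_val]
  exact Nat.left_le_pair _ _

theorem encode_le_encode_pair_right {α β : Type*} [Encodable α] [Encodable β] (a : α) (b : β) :
    encode b ≤ encode (a, b) := by
  rw [encode_prod_val]
  exact Nat.right_le_pair _ _

theorem encode_le_encode_inl {α β : Type*} [Encodable α] [Encodable β] (a : α) :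
    encode a ≤ encode (Sum.inl a : α ⊕ β) := by
  rw [encode_inl]
  omega

theorem encode_le_encode_inr {α β : Type*} [Encodable α] [Encodable β] (b : β) :
    encode b ≤ encode (Sum.inr b : α ⊕ β) := by
  rw [encode_inr]
  omega

theorem Constraint.bounded_of_encode_lt {n : ℕ} {a : Constraint} (h : encode a < n) :
    a.Bounded n := by
  cases a with
  | ground s r t =>
    have h0 : encode (Constraint.ground s r t) =
      encode (Sum.inl (s, r, t) : (GTerm × Rel × GTerm) ⊕ (ℕ × Rel × GTerm) ⊕ (ℕ × Rel × ℕ)) := rfl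
    rw [h0] at h
    have h1 := (encode_le_encode_inl _).trans_lt h
    have h2 := (encode_le_encode_pair_left _ _).trans_lt h1
    have h3 := ((encode_le_encode_pair_right _ _).trans
      (encode_le_encode_pair_right _ _)).trans_lt h1
    exact ⟨h2, h3⟩
  | varTerm x r t =>
    have h0 : encode (Constraint.varTerm x r t) = encode (Sum.inr (Sum.inl (x, r, t)) :
      (GTerm × Rel × GTerm) ⊕ (ℕ × Rel × GTerm) ⊕ (ℕ × Rel × ℕ)) := rfl
    rw [h0] at h
    have h1 := ((encode_le_encode_inl _).trans (encode_le_encode_inr _)).trans_lt h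
    have h2 := (encode_le_encode_pair_left _ _).trans_lt h1
    have h3 := ((encode_le_encode_pair_right _ _).trans
      (encode_le_encode_pair_right _ _)).trans_lt h1
    exact ⟨h2, h3⟩
  | varVar x r y =>
    have h0 : encode (Constraint.varVar x r y) = encode (Sum.inr (Sum.inr (x, r, y)) :
      (GTerm × Rel × GTerm) ⊕ (ℕ × Rel × GTerm) ⊕ (ℕ × Rel × ℕ)) := rfl
    rw [h0] at h
    have h1 := ((encode_le_encode_inr _).trans (encode_le_encode_inr _)).trans_lt h
    have h2 := (encode_le_encode_pair_left _ _).trans_lt h1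
    have h3 := ((encode_le_encode_pair_right _ _).trans
      (encode_le_encode_pair_right _ _)).trans_lt h1
    exact ⟨h2, h3⟩

theorem FTerm.bounded_of_encode_lt {n : ℕ} {a : FTerm} (h : encode a < n) : a.Bounded n := by
  cases a with
  | var v =>
    have h0 : encode (FTerm.var v) = encode (Sum.inl v : ℕ ⊕ ℕ) := rfl
    exact (encode_le_encode_inl (β := ℕ) v).trans_lt (h0 ▸ h)
  | const c =>
    have h0 : encode (FTerm.const c) = encode (Sum.inr c : ℕ ⊕ ℕ) := rfl
    exact (encode_le_encode_inr (α := ℕ) c).trans_lt (h0 ▸ h)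

theorem Arg.bounded_of_encode_lt {n : ℕ} {a : Arg} (h : encode a < n) : a.Bounded n := by
  cases a with
  | base x =>
    have h0 : encode (Arg.base x) = encode (Sum.inl x : ℕ ⊕ FTerm) := rfl
    exact (encode_le_encode_inl (β := FTerm) x).trans_lt (h0 ▸ h)
  | free s =>
    have h0 : encode (Arg.free s) = encode (Sum.inr s : ℕ ⊕ FTerm) := rfl
    exact FTerm.bounded_of_encode_lt ((encode_le_encode_inr (α := ℕ) s).trans_lt (h0 ▸ h))

theorem Atom.bounded_of_encode_lt {n : ℕ} {a : Atom} (h : encode a < n) : a.Bounded n := by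
  cases a with
  | eq s t =>
    have h0 : encode (Atom.eq s t) =
      encode (Sum.inl (s, t) : (FTerm × FTerm) ⊕ (ℕ × List Arg)) := rfl
    have h1 := (encode_le_encode_inl _).trans_lt (h0 ▸ h)
    exact ⟨FTerm.bounded_of_encode_lt ((encode_le_encode_pair_left _ _).trans_lt h1),
      FTerm.bounded_of_encode_lt ((encode_le_encode_pair_right _ _).trans_lt h1)⟩
  | pred P l =>
    have h0 : encode (Atom.pred P l) =
      encode (Sum.inr (P, l) : (FTerm × FTerm) ⊕ (ℕ × List Arg)) := rfl
    have h1 := (encode_le_encode_inr _).trans_lt (h0 ▸ h)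
    have h2 := (encode_le_encode_pair_right _ _).trans_lt h1
    exact ⟨(encode_le_encode_pair_left _ _).trans_lt h1, (length_le_encode _).trans_lt h2,
      fun a ha => Arg.bounded_of_encode_lt ((encode_le_encode_of_mem ha).trans h2)⟩

theorem Clause.bounded_of_encode_lt {n : ℕ} {C : Clause} (h : encode C < n) : C.Bounded n := by
  have h0 : encode C = encode (C.constraints, C.antecedent, C.succedent) := rfl
  rw [h0] at h
  have h1 := (encode_le_encode_pair_left _ _).trans_lt h
  have h2 := (encode_le_encode_pair_right _ _).trans_lt h
  have h3 := (encode_le_encode_pair_left _ _).trans_lt h2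
  have h4 := (encode_le_encode_pair_right _ _).trans_lt h2
  exact ⟨fun a ha => Constraint.bounded_of_encode_lt ((encode_le_encode_of_mem ha).trans h1),
    fun a ha => Atom.bounded_of_encode_lt ((encode_le_encode_of_mem ha).trans h3),
    fun a ha => Atom.bounded_of_encode_lt ((encode_le_encode_of_mem ha).trans h4)⟩

/-- A bound for everything that occurs in a clause set. -/
def bound (N : ClauseSet) : ℕ := encode N + 1

theorem bounded_of_mem {N : ClauseSet} {C : Clause} (h : C ∈ N) : C.Bounded (bound N) :=
  Clause.bounded_of_encode_lt ((encode_le_encode_of_mem h).trans (Nat.lt_succ_self _))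

/-! ### From grids to models -/

/-- A value is sent to the last cut at or below it (or 0) and, unless it lies on a cut, shifted by
one plus the number of smaller values of `β`. The shift is at most `n`, so the next cut is never
reached. -/
theorem exists_grid_points (n : ℕ) (κ : ℕ → ℕ) (v : ℕ → ℝ) (hn : ∀ i < n, κ i < n)
    (hκ : ∀ i < n, ∀ j < n, κ i < κ j ↔ v i < v j) (β : ℕ → ℝ) :
    ∃ b : ℕ → ℕ, (∀ x < n, b x < gridSize n) ∧
      (∀ x < n, ∀ y < n, cmpCode (b x) (b y) = cmpCode (β x) (β y)) ∧
      ∀ x < n, ∀ i < n, cmpCode (b x) ((κ i + 1) * (n + 1)) = cmpCode (β x) (v i) := by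
  classical
  let base : ℝ → ℕ := fun y => ((Finset.range n).filter (v · ≤ y)).sup fun i => (κ i + 1) * (n + 1)
  let cnt : ℝ → ℕ := fun y => (((Finset.range n).image β).filter (· < y)).card
  let g : ℝ → ℕ := fun y => base y + if ∃ i < n, v i = y then 0 else 1 + cnt y
  have hbase : ∀ {y : ℝ} {i}, i < n → v i ≤ y → (κ i + 1) * (n + 1) ≤ base y := fun hi h =>
    Finset.le_sup (f := fun i => (κ i + 1) * (n + 1)) (by simp [hi, h])
  have hcnt : ∀ x < n, cnt (β x) < n := by
    intro x hx
    have : (((Finset.range n).image β).filter (· < β x)).card < ((Finset.range n).image β).card := by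
      refine Finset.card_lt_card ((Finset.filter_ssubset).2 ⟨β x, ?_, lt_irrefl _⟩)
      exact Finset.mem_image_of_mem _ (Finset.mem_range.2 hx)
    exact this.trans_le (Finset.card_image_le.trans (by simp))
  have hg : ∀ x < n, g (β x) ≤ base (β x) + n := by
    intro x hx
    have := hcnt x hx
    simp only [g]
    split_ifs <;> omega
  have hlt : ∀ x < n, ∀ i < n, β x < v i → g (β x) < (κ i + 1) * (n + 1) := by
    intro x hx i hi h
    have h1 : base (β x) ≤ κ i * (n + 1) := by
      refine Finset.sup_le fun j hj => ?_
      simp only [Finset.mem_filter, Finset.mem_range] at hj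
      exact Nat.mul_le_mul_right _ ((hκ j hj.1 i hi).2 (hj.2.trans_lt h))
    have h2 := hg x hx
    rw [Nat.add_mul]
    omega
  have heq : ∀ x, ∀ i < n, β x = v i → g (β x) = (κ i + 1) * (n + 1) := by
    intro x i hi h
    simp only [g]
    rw [if_pos ⟨i, hi, h.symm⟩, Nat.add_zero]
    refine le_antisymm (Finset.sup_le fun j hj => ?_) (hbase hi h.ge)
    simp only [Finset.mem_filter, Finset.mem_range] at hj
    refine Nat.mul_le_mul_right _ (Nat.succ_le_succ (not_lt.1 fun h' => ?_))
    exact ((hκ i hi j hj.1).1 h').not_ge (h ▸ hj.2)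
  have hgt : ∀ x < n, ∀ i < n, v i < β x → (κ i + 1) * (n + 1) < g (β x) := by
    intro x hx i hi h
    by_cases hc : ∃ k < n, v k = β x
    · obtain ⟨k, hk, hk'⟩ := hc
      rw [heq x k hk hk'.symm]
      have := (hκ i hi k hk).2 (hk' ▸ h)
      exact Nat.mul_lt_mul_of_pos_right (by omega) (by omega)
    · have := hbase hi h.le
      simp only [g]
      rw [if_neg hc]
      omega
  have hmono : ∀ x < n, ∀ y < n, β x < β y → g (β x) < g (β y) := by
    intro x hx y hy h
    by_cases hc : ∃ k < n, v k = β y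
    · obtain ⟨k, hk, hk'⟩ := hc
      rw [heq y k hk hk'.symm]
      exact hlt x hx k hk (hk' ▸ h)
    · have h1 : base (β x) ≤ base (β y) := by
        refine Finset.sup_mono fun i hi => ?_
        simp only [Finset.mem_filter, Finset.mem_range] at hi ⊢
        exact ⟨hi.1, hi.2.trans h.le⟩
      have h2 : cnt (β x) < cnt (β y) := by
        refine Finset.card_lt_card ((Finset.ssubset_iff_of_subset fun r hr => ?_).2
          ⟨β x, ?_, ?_⟩)
        · simp only [Finset.mem_filter] at hr ⊢
          exact ⟨hr.1, hr.2.trans h⟩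
        · exact Finset.mem_filter.2 ⟨Finset.mem_image_of_mem _ (Finset.mem_range.2 hx), h⟩
        · simp
      simp only [g]
      rw [if_neg hc]
      split_ifs <;> omega
  refine ⟨fun x => g (β x), fun x hx => ?_, fun x hx y hy => ?_, fun x hx i hi => ?_⟩
  · have h1 : base (β x) ≤ n * (n + 1) := by
      refine Finset.sup_le fun j hj => ?_
      simp only [Finset.mem_filter, Finset.mem_range] at hj
      exact Nat.mul_le_mul_right _ (hn j hj.1)
    have h2 := hg x hx
    simp only [gridSize]
    nlinarith
  · rcases lt_trichotomy (β x) (β y) with h | h | h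
    · have := hmono x hx y hy h
      exact cmpCode_eq_cmpCode.2 (by simp [h, this, h.not_gt, this.not_gt])
    · simp [h, cmpCode]
    · have := hmono y hy x hx h
      exact cmpCode_eq_cmpCode.2 (by simp [h, this, h.not_gt, this.not_gt])
  · rcases lt_trichotomy (β x) (v i) with h | h | h
    · have := hlt x hx i hi h
      exact cmpCode_eq_cmpCode.2 (by simp [h, this, h.not_gt, this.not_gt])
    · simp [h, cmpCode, ← heq x i hi h]
    · have := hgt x hx i hi h
      exact cmpCode_eq_cmpCode.2 (by simp [h, this, h.not_gt, this.not_gt])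

theorem Rel.holdsNat_iff (r : Rel) {a b : ℕ} {x y : ℝ} (h : cmpCode a b = cmpCode x y) :
    r.HoldsNat a b ↔ r.Holds x y := by
  obtain ⟨h1, h2⟩ := cmpCode_eq_cmpCode.1 h
  have h3 : a ≤ b ↔ x ≤ y := by rw [← not_lt, h2, not_lt]
  have h4 : b ≤ a ↔ y ≤ x := by rw [← not_lt, h1, not_lt]
  cases r <;> simp [Rel.HoldsNat, Rel.Holds, h1, h2, h3, h4, le_antisymm_iff]

theorem cmpCode_scale {n : ℕ} {κ : ℕ → ℕ} {v : ℕ → ℝ}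
    (hκ : ∀ i < n, ∀ j < n, κ i < κ j ↔ v i < v j) {i j : ℕ} (hi : i < n) (hj : j < n) :
    cmpCode ((κ i + 1) * (n + 1)) ((κ j + 1) * (n + 1)) = cmpCode (v i) (v j) := by
  rw [cmpCode_eq_cmpCode, ← hκ i hi j hj, ← hκ j hj i hi]
  simp

/-- The cuts given by a scaled order type. -/
theorem scale_eq_map_range {n : ℕ} {ρ : List ℕ} (h : ρ.length = n) :
    scale n ρ = (List.range n).map fun i => (ρ.getD i 0 + 1) * (n + 1) := by
  refine List.ext_getElem (by simp [scale, h]) fun i h1 h2 => ?_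
  have : i < ρ.length := by simpa [scale] using h1
  simp [scale, List.getD, this]

/-- The interpretation of the predicates by a list of types. -/
def gridInterpretation (n : ℕ) (hn : 0 < n) (σ : ℕ → ℝ) (e : List ℕ) (V : List GroundType) :
    Interpretation.{u} where
  Dom := ULift.{u} {d : ℕ // ∃ c < n, e.getD c 0 = d}
  nonempty := ⟨⟨⟨e.getD 0 0, 0, hn, rfl⟩⟩⟩
  skolem := σ
  -- Constants from `n` on do not occur in the clauses, so any element serves.
  const c := if h : c < n then ⟨⟨e.getD c 0, c, h, rfl⟩⟩ else ⟨⟨e.getD 0 0, 0, hn, rfl⟩⟩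
  pred P := {l | (P, tupleType ((List.range n).map fun i => (GTerm.ofNat i).eval σ 1)
    (l.map (Sum.map id fun d => d.down.1))) ∈ V}

/-- Given a real assignment, grid points in the same arrangement and constants naming the free-sort
values satisfy exactly the same bounded atoms. -/
theorem satisfiable_of_gridSatisfiable {n : ℕ} (hn : 0 < n) {ρ : List ℕ} {N : ClauseSet}
    (hN : ∀ C ∈ N, C.Bounded n) (hρ : ρ ∈ words (List.range n) n) {σ : ℕ → ℝ}
    (hσ : OrderTypeAt n ρ σ) (h : GridSatisfiable n ρ N) : Satisfiable.{u} N := by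
  obtain ⟨e, -, V, -, hmodel⟩ := h
  let A := gridInterpretation.{u} n hn σ e V
  refine ⟨A, fun C hC β => ?_⟩
  let κ : ℕ → ℕ := fun i => ρ.getD i 0
  let v : ℕ → ℝ := fun i => (GTerm.ofNat i).eval σ 1
  obtain ⟨b, hb, hbb, hbv⟩ := exists_grid_points n κ v
    (fun i _ => getD_lt_of_mem_words hn hρ) hσ β.base
  have hfree : ∀ d : A.Dom, ∃ c < n, e.getD c 0 = d.down.1 := fun d => d.down.2
  choose f hf hfe using fun x => hfree (β.free x)
  have key := hmodel C hC _ (map_range_mem_words hb) _ (map_range_mem_words fun i _ => hf i)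
  have hcuts := scale_eq_map_range (mem_words.1 hρ).1
  have hcut : ∀ t : GTerm, t.toNat < n →
      (scale n ρ).getD t.toNat 0 = (κ t.toNat + 1) * (n + 1) ∧ t.val A = v t.toNat := by
    intro t ht
    refine ⟨by rw [hcuts, getD_map_range _ _ ht], ?_⟩
    rw [GTerm.val_eq_eval]
    simp only [v, GTerm.ofNat_toNat]
    rfl
  have hconstraint : ∀ a : Constraint, a.Bounded n →
      (a.GridHolds (scale n ρ) ((List.range n).map b) ↔ a.Holds A β) := by
    rintro (⟨s, r, t⟩ | ⟨x, r, t⟩ | ⟨x, r, y⟩) ⟨h1, h2⟩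
    · simp only [Constraint.GridHolds, Constraint.Holds]
      rw [(hcut s h1).1, (hcut s h1).2, (hcut t h2).1, (hcut t h2).2]
      exact r.holdsNat_iff (cmpCode_scale hσ h1 h2)
    · simp only [Constraint.GridHolds, Constraint.Holds]
      rw [getD_map_range _ _ h1, (hcut t h2).1, (hcut t h2).2]
      exact r.holdsNat_iff (hbv x h1 _ h2)
    · simp only [Constraint.GridHolds, Constraint.Holds]
      rw [getD_map_range _ _ h1, getD_map_range _ _ h2]
      exact r.holdsNat_iff (hbb x h1 y h2)
  have hterm : ∀ s : FTerm, s.Bounded n →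
      s.gridVal e ((List.range n).map f) = (s.val A β).down.1 := by
    rintro (x | c) h1
    · simp only [FTerm.gridVal, FTerm.val]
      rw [getD_map_range _ _ h1, hfe]
    · have hc : A.const c = ⟨⟨e.getD c 0, c, h1, rfl⟩⟩ := dif_pos h1
      simp only [FTerm.gridVal, FTerm.val, hc]
  have hatom : ∀ a : Atom, a.Bounded n →
      (a.GridHolds (scale n ρ) e V ((List.range n).map b) ((List.range n).map f) ↔
        a.Holds A β) := by
    rintro (⟨s, t⟩ | ⟨P, args⟩) hbd
    · simp only [Atom.GridHolds, Atom.Holds]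
      rw [hterm s hbd.1, hterm t hbd.2]
      exact ⟨fun h => ULift.ext _ _ (Subtype.ext h), fun h => by rw [h]⟩
    · obtain ⟨-, -, hargs⟩ := hbd
      have ht : tupleType (scale n ρ)
          (args.map (Arg.gridVal e ((List.range n).map b) ((List.range n).map f))) =
          tupleType ((List.range n).map v)
            (args.map fun a => Sum.map id (fun d : A.Dom => d.down.1) (a.val A β)) := by
        rw [hcuts]
        refine tupleType_map_eq _ _ _ _ _ _ (fun a ha => ?_) fun a ha a' ha' => ?_
        · have hba := hargs a ha
          rcases a with x | s
          · left
            refine ⟨_, _, rfl, rfl, fun i hi => ?_⟩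
            rw [getD_map_range _ _ hba]
            exact hbv x hba i (List.mem_range.1 hi)
          · right
            refine ⟨_, rfl, ?_⟩
            rw [hterm s hba]
            rfl
        · have hba := hargs a ha
          have hba' := hargs a' ha'
          rcases a with x | s <;> rcases a' with x' | s' <;>
            simp only [Arg.gridVal, Arg.val, Sum.map_inl, Sum.map_inr, id, Sum.inl.injEq,
              reduceCtorEq, false_implies, implies_true]
          rintro _ _ _ _ rfl rfl rfl rfl
          rw [getD_map_range _ _ hba, getD_map_range _ _ hba']
          exact hbb x hba x' hba'
      simp only [Atom.GridHolds, Atom.Holds]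
      rw [ht]
      change _ ↔ (P, tupleType ((List.range n).map v) ((args.map (Arg.val A β)).map
        (Sum.map id fun d : A.Dom => d.down.1))) ∈ V
      rw [List.map_map]
      rfl
  obtain ⟨hb1, hb2, hb3⟩ := hN C hC
  rintro ⟨h1, h2⟩
  obtain ⟨a, ha, hah⟩ := key ⟨fun a ha => (hconstraint a (hb1 a ha)).2 (h1 a ha),
    fun a ha => (hatom a (hb2 a ha)).2 (h2 a ha)⟩
  exact ⟨a, ha, (hatom a (hb3 a ha)).1 hah⟩

/-! ### From models to grids -/

/-- A term is ranked by the number of distinct values strictly below its own. -/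
theorem exists_orderTypeAt (n : ℕ) (σ : ℕ → ℝ) :
    ∃ ρ ∈ words (List.range n) n, OrderTypeAt n ρ σ := by
  classical
  let v : ℕ → ℝ := fun i => (GTerm.ofNat i).eval σ 1
  let r : ℕ → ℕ := fun i => (((Finset.range n).image v).filter (· < v i)).card
  have hr : ∀ i < n, r i < n := by
    intro i hi
    have : (((Finset.range n).image v).filter (· < v i)).card < ((Finset.range n).image v).card := by
      refine Finset.card_lt_card ((Finset.filter_ssubset).2 ⟨v i, ?_, lt_irrefl _⟩)
      exact Finset.mem_image_of_mem _ (Finset.mem_range.2 hi)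
    exact this.trans_le (Finset.card_image_le.trans (by simp))
  have hmono : ∀ i j, v i ≤ v j → r i ≤ r j := fun i j h =>
    Finset.card_le_card fun x hx => by
      simp only [Finset.mem_filter] at hx ⊢
      exact ⟨hx.1, hx.2.trans_le h⟩
  refine ⟨(List.range n).map r, map_range_mem_words hr, fun i hi j hj => ?_⟩
  rw [getD_map_range _ _ hi, getD_map_range _ _ hj]
  refine ⟨fun h => not_le.1 fun h' => h.not_ge (hmono j i h'), fun h => ?_⟩
  refine Finset.card_lt_card ((Finset.ssubset_iff_of_subset fun x hx => ?_).2 ⟨v i, ?_, ?_⟩)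
  · simp only [Finset.mem_filter] at hx ⊢
    exact ⟨hx.1, hx.2.trans h⟩
  · exact Finset.mem_filter.2 ⟨Finset.mem_image_of_mem _ (Finset.mem_range.2 hi), h⟩
  · simp

theorem mem_gridTuples {n P : ℕ} {l : List (ℕ ⊕ ℕ)} :
    (P, l) ∈ gridTuples n ↔ P < n ∧ l.length < n ∧ ∀ a ∈ l, a ∈ gridArgs n := by
  simp only [gridTuples, List.mem_flatMap, List.mem_map, List.mem_range, mem_words, Prod.mk.injEq]
  constructor
  · rintro ⟨P, hP, k, hk, l, ⟨hl, hl'⟩, rfl, rfl⟩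
    exact ⟨hP, hl ▸ hk, hl'⟩
  · rintro ⟨hP, hl, hl'⟩
    exact ⟨P, hP, l.length, hl, l, ⟨rfl, hl'⟩, rfl, rfl⟩

/-- A grid assignment is read in `A` through the uniform points `z` and the constants, and `A`
satisfies the clauses under the resulting assignment. -/
theorem exists_gridSatisfiable {n : ℕ} (hn : 0 < n) {N : ClauseSet} (hN : ∀ C ∈ N, C.Bounded n)
    {A : Interpretation.{u}} (hA : A.IsModel N) {ρ : List ℕ} (hρ : ρ ∈ words (List.range n) n)
    (hσ : OrderTypeAt n ρ A.skolem) : GridSatisfiable n ρ N := by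
  classical
  let κ : ℕ → ℕ := fun i => ρ.getD i 0
  let cut : ℕ → ℕ := fun i => (κ i + 1) * (n + 1)
  let v : ℕ → ℝ := fun i => (GTerm.ofNat i).eval A.skolem 1
  have hcuts : scale n ρ = (List.range n).map cut := scale_eq_map_range (mem_words.1 hρ).1
  have hcut : ∀ i < n, ∀ j < n, cut i < cut j ↔ v i < v j := fun i hi j hj =>
    (cmpCode_eq_cmpCode.1 (cmpCode_scale hσ hi hj)).1
  obtain ⟨z, hz, hzv, hpred⟩ := exists_uniform_points n (gridSize n) cut v hcut A.const A.pred
    (gridTuples n) (fun x hx p hp => by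
      have := (mem_gridTuples.1 hx).2.2 _ hp
      simpa [gridArgs] using this)
  have hrep : ∀ c : ℕ, ∃ d, A.const d = A.const c := fun c => ⟨c, rfl⟩
  -- The least constant with the same denotation; being at most `c`, it stays below `n`.
  let r : ℕ → ℕ := fun c => Nat.find (hrep c)
  have hr : ∀ c, A.const (r c) = A.const c := fun c => Nat.find_spec (hrep c)
  have hrle : ∀ c, r c ≤ c := fun c => Nat.find_le rfl
  have hrr : ∀ {c d}, r c = r d ↔ A.const c = A.const d := by
    intro c d
    refine ⟨fun h => by rw [← hr c, h, hr d], fun h => ?_⟩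
    simp only [r]
    congr 1
    simp only [h]
  let e : List ℕ := (List.range n).map r
  have he : e ∈ words (List.range n) n := map_range_mem_words fun i hi => (hrle i).trans_lt hi
  -- A type is put in the table if some grid tuple of that type satisfies the predicate; by
  -- uniformity, all of them then do.
  obtain ⟨V, hV, hVp⟩ := exists_mem_subsets (gridTypes n (scale n ρ)) fun τ =>
    ∃ l, (τ.1, l) ∈ gridTuples n ∧ tupleType (scale n ρ) l = τ.2 ∧
      l.map (Sum.map z A.const) ∈ A.pred τ.1
  have hsize : 0 < gridSize n := by simp [gridSize]
  refine ⟨e, he, V, hV, fun C hC b hb f hf => ?_⟩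
  let β : Assignment A := ⟨fun x => z (b.getD x 0), fun x => A.const (f.getD x 0)⟩
  have hval : ∀ t : GTerm, t.toNat < n →
      (scale n ρ).getD t.toNat 0 = cut t.toNat ∧ t.val A = v t.toNat := by
    intro t ht
    refine ⟨by rw [hcuts, getD_map_range _ _ ht], ?_⟩
    rw [GTerm.val_eq_eval]
    simp only [v, GTerm.ofNat_toNat]
  have hconstraint : ∀ a : Constraint, a.Bounded n →
      (a.GridHolds (scale n ρ) b ↔ a.Holds A β) := by
    rintro (⟨s, r, t⟩ | ⟨x, r, t⟩ | ⟨x, r, y⟩) ⟨h1, h2⟩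
    · simp only [Constraint.GridHolds, Constraint.Holds]
      rw [(hval s h1).1, (hval s h1).2, (hval t h2).1, (hval t h2).2]
      exact r.holdsNat_iff (cmpCode_scale hσ h1 h2)
    · simp only [Constraint.GridHolds, Constraint.Holds]
      rw [(hval t h2).1, (hval t h2).2]
      exact r.holdsNat_iff (hzv _ _ h2)
    · simp only [Constraint.GridHolds, Constraint.Holds]
      exact r.holdsNat_iff (hz _ (getD_lt_of_mem_words hsize hb) _ (getD_lt_of_mem_words hsize hb))
  have hterm : ∀ s : FTerm, s.Bounded n → ∃ c, c < n ∧ s.gridVal e f = r c ∧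
      s.val A β = A.const c := by
    rintro (x | c) h1
    · have hlt : f.getD x 0 < n := getD_lt_of_mem_words hn hf
      exact ⟨f.getD x 0, hlt, getD_map_range _ _ hlt, rfl⟩
    · exact ⟨c, h1, getD_map_range _ _ h1, rfl⟩
  have hatom : ∀ a : Atom, a.Bounded n →
      (a.GridHolds (scale n ρ) e V b f ↔ a.Holds A β) := by
    rintro (⟨s, t⟩ | ⟨P, args⟩) hbd
    · simp only [Atom.GridHolds, Atom.Holds]
      obtain ⟨c, -, h1, h2⟩ := hterm s hbd.1
      obtain ⟨d, -, h3, h4⟩ := hterm t hbd.2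
      rw [h1, h2, h3, h4, hrr]
    · obtain ⟨hP, hlen, hargs⟩ := hbd
      have hmem : (P, args.map (Arg.gridVal e b f)) ∈ gridTuples n := by
        refine mem_gridTuples.2 ⟨hP, by simpa using hlen, fun a ha => ?_⟩
        obtain ⟨a', ha', rfl⟩ := List.mem_map.1 ha
        have hba := hargs a' ha'
        rcases a' with x | s
        · have := getD_lt_of_mem_words (x := x) hsize hb
          simpa [gridArgs, Arg.gridVal] using this
        · obtain ⟨c, hc, h1, -⟩ := hterm s hba
          have := (hrle c).trans_lt hc
          simpa [gridArgs, Arg.gridVal, h1] using this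
      have hmap : args.map (Arg.val A β) =
          (args.map (Arg.gridVal e b f)).map (Sum.map z A.const) := by
        rw [List.map_map]
        refine List.map_congr_left fun a ha => ?_
        have hba := hargs a ha
        rcases a with x | s
        · rfl
        · obtain ⟨c, -, h1, h2⟩ := hterm s hba
          simp [Arg.val, Arg.gridVal, h1, h2, hr]
      simp only [Atom.GridHolds, Atom.Holds]
      rw [hVp, hmap]
      constructor
      · rintro ⟨-, l, hl, ht, hp⟩
        rw [hcuts] at ht
        exact (hpred P _ _ hl hmem ht).1 hp
      · intro hp
        exact ⟨List.mem_map.2 ⟨_, hmem, rfl⟩, _, hmem, rfl, hp⟩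
  obtain ⟨hb1, hb2, hb3⟩ := hN C hC
  rintro ⟨h1, h2⟩
  obtain ⟨a, ha, hah⟩ := hA C hC β ⟨fun a ha => (hconstraint a (hb1 a ha)).1 (h1 a ha),
    fun a ha => (hatom a (hb2 a ha)).1 (h2 a ha)⟩
  exact ⟨a, ha, (hatom a (hb3 a ha)).2 hah⟩

theorem satisfiable_iff (N : ClauseSet) : Satisfiable.{u} N ↔
    ∃ ρ ∈ words (List.range (bound N)) (bound N),
      (∃ σ : ℕ → ℝ, OrderTypeAt (bound N) ρ σ) ∧ GridSatisfiable (bound N) ρ N := by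
  have hn : 0 < bound N := Nat.succ_pos _
  constructor
  · rintro ⟨A, hA⟩
    obtain ⟨ρ, hρ, hσ⟩ := exists_orderTypeAt (bound N) A.skolem
    exact ⟨ρ, hρ, ⟨_, hσ⟩, exists_gridSatisfiable hn (fun C => bounded_of_mem) hA hρ hσ⟩
  · rintro ⟨ρ, hρ, ⟨σ, hσ⟩, h⟩
    exact satisfiable_of_gridSatisfiable hn (fun C => bounded_of_mem) hρ hσ h

/-! ### Primitive recursive predicates -/

section Primrec

variable {α β γ σ : Type*} [Primcodable α] [Primcodable β] [Primcodable γ] [Primcodable σ]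

theorem primrecPred_forall_mem {f : α → List β} {p : α → β → Prop} (hf : Primrec f)
    (hp : PrimrecRel p) : PrimrecPred fun a => ∀ b ∈ f a, p a b :=
  (PrimrecRel.forall_mem_list (R := fun b a => p a b) hp.swap).comp hf Primrec.id

theorem primrecPred_exists_mem {f : α → List β} {p : α → β → Prop} (hf : Primrec f)
    (hp : PrimrecRel p) : PrimrecPred fun a => ∃ b ∈ f a, p a b :=
  (PrimrecRel.exists_mem_list (R := fun b a => p a b) hp.swap).comp hf Primrec.id

theorem primrecPred_forall_lt {f : α → ℕ} {p : α → ℕ → Prop} (hf : Primrec f)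
    (hp : PrimrecRel p) : PrimrecPred fun a => ∀ i < f a, p a i :=
  (primrecPred_forall_mem (Primrec.list_range.comp hf) hp).of_eq fun a => by simp

theorem primrecPred_exists_lt {f : α → ℕ} {p : α → ℕ → Prop} (hf : Primrec f)
    (hp : PrimrecRel p) : PrimrecPred fun a => ∃ i < f a, p a i :=
  (primrecPred_exists_mem (Primrec.list_range.comp hf) hp).of_eq fun a => by simp

theorem primrecPred_imp {p q : α → Prop} (hp : PrimrecPred p) (hq : PrimrecPred q) :
    PrimrecPred fun a => p a → q a :=
  (hp.not.or hq).of_eq fun _ => imp_iff_not_or.symm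

theorem primrecPred_iff {p q : α → Prop} (hp : PrimrecPred p) (hq : PrimrecPred q) :
    PrimrecPred fun a => p a ↔ q a :=
  ((primrecPred_imp hp hq).and (primrecPred_imp hq hp)).of_eq fun _ => iff_def.symm

theorem primrecPred_sumElim {f : α → β ⊕ γ} {p : α → β → Prop} {q : α → γ → Prop}
    (hf : Primrec f) (hp : PrimrecRel p) (hq : PrimrecRel q) :
    PrimrecPred fun a => Sum.elim (p a) (q a) (f a) := by
  classical
  -- The case distinction is carried out on Boolean values, as a primitive recursive function.
  refine PrimrecPred.of_eq (p := fun a =>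
    (Sum.casesOn (f a) (fun b => decide (p a b)) fun c => decide (q a c) : Bool) = true) ?_ ?_
  · exact Primrec.eq.comp (Primrec.sumCasesOn hf hp.decide hq.decide) (Primrec.const true)
  · intro a
    cases f a <;> simp

theorem primrec_sumElim {f : α → β ⊕ γ} {g : α → β → σ} {h : α → γ → σ}
    (hf : Primrec f) (hg : Primrec₂ g) (hh : Primrec₂ h) :
    Primrec fun a => Sum.elim (g a) (h a) (f a) :=
  (Primrec.sumCasesOn hf hg hh).of_eq fun a => by cases f a <;> rfl

theorem primrecPred_mem {f : α → β} {g : α → List β} (hf : Primrec f) (hg : Primrec g) :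
    PrimrecPred fun a => f a ∈ g a :=
  (primrecPred_exists_mem (p := fun a b => b = f a) hg
    (Primrec.eq.comp Primrec.snd (hf.comp Primrec.fst))).of_eq fun a => by simp

theorem primrec_getD {f : α → List β} {g : α → ℕ} (hf : Primrec f) (hg : Primrec g) (d : β) :
    Primrec fun a => (f a).getD (g a) d :=
  (Primrec.list_getD d).comp hf hg

theorem rePred_of_exists {p : α → Prop} {q : α → ℕ → Prop} (hq : PrimrecRel q)
    (h : ∀ a, p a ↔ ∃ k, q a k) : REPred p := by
  classical
  have hr : Partrec fun a => Nat.rfind fun k => (Part.some (decide (q a k)) : Part Bool) :=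
    Partrec.rfind (Primrec.to_comp hq.decide).partrec
  refine (Partrec.dom_re hr).of_eq fun a => ?_
  rw [h]
  exact Nat.rfind_dom.trans (by simp)

theorem primrec_words : Primrec₂ (words : List α → ℕ → List (List α)) := by
  have hstep : Primrec₂ fun (x : List α × ℕ) (y : ℕ × List (List α)) =>
      y.2.flatMap fun l => x.1.map (· :: l) := by
    refine Primrec.list_flatMap (Primrec.snd.comp Primrec.snd) ?_
    refine Primrec.list_map (Primrec.fst.comp (Primrec.fst.comp Primrec.fst)) ?_
    exact Primrec.list_cons.comp Primrec.snd (Primrec.snd.comp Primrec.fst)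
  refine (Primrec.nat_rec' (f := fun x : List α × ℕ => x.2) (g := fun _ => [[]])
    Primrec.snd (Primrec.const _) hstep).of_eq fun x => ?_
  obtain ⟨a, k⟩ := x
  induction k with
  | zero => rfl
  | succ k ih =>
    simp only at ih ⊢
    rw [words, ← ih]

theorem primrec_subsets : Primrec (subsets : List α → List (List α)) := by
  refine Primrec.list_foldr (h := fun _ (p : α × List (List α)) => p.2 ++ p.2.map (p.1 :: ·))
    Primrec.id (Primrec.const [[]]) ?_
  refine Primrec.list_append.comp (Primrec.snd.comp Primrec.snd) ?_
  refine Primrec.list_map (Primrec.snd.comp Primrec.snd) ?_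
  exact Primrec.list_cons.comp (Primrec.fst.comp (Primrec.snd.comp Primrec.fst)) Primrec.snd

end Primrec

/-! ### Certificates for the realizability of order types -/

section Frac

open Primrec

theorem primrec_fracNeg : Primrec Frac.neg :=
  (fst.comp snd).pair (fst.pair (snd.comp snd))

theorem primrec_fracAdd : Primrec₂ Frac.add := by
  have hx : Primrec fun p : Frac × Frac => p.1.2.2 + 1 :=
    succ.comp (snd.comp (snd.comp fst))
  have hy : Primrec fun p : Frac × Frac => p.2.2.2 + 1 :=
    succ.comp (snd.comp (snd.comp snd))
  refine pair ?_ (pair ?_ ?_)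
  · exact nat_add.comp (nat_mul.comp (fst.comp fst) hy) (nat_mul.comp (fst.comp snd) hx)
  · exact nat_add.comp (nat_mul.comp (fst.comp (snd.comp fst)) hy)
      (nat_mul.comp (fst.comp (snd.comp snd)) hx)
  · have h1 : Primrec fun p : Frac × Frac => p.1.2.2 := snd.comp (snd.comp fst)
    have h2 : Primrec fun p : Frac × Frac => p.2.2.2 := snd.comp (snd.comp snd)
    exact nat_add.comp (nat_add.comp (nat_mul.comp h1 h2) h1) h2

theorem primrecRel_fracLT : PrimrecRel Frac.LT := by
  have hx : Primrec fun p : Frac × Frac => p.1.2.2 + 1 :=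
    succ.comp (snd.comp (snd.comp fst))
  have hy : Primrec fun p : Frac × Frac => p.2.2.2 + 1 :=
    succ.comp (snd.comp (snd.comp snd))
  exact nat_lt.comp
    (nat_add.comp (nat_mul.comp (fst.comp fst) hy) (nat_mul.comp (fst.comp (snd.comp snd)) hx))
    (nat_add.comp (nat_mul.comp (fst.comp snd) hx) (nat_mul.comp (fst.comp (snd.comp fst)) hy))

theorem intEquivNat_symm (m : ℕ) :
    Equiv.intEquivNat.symm m = if m % 2 = 0 then ((m / 2 : ℕ) : ℤ) else Int.negSucc (m / 2) := by
  rw [Equiv.symm_apply_eq]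
  split_ifs with h
  · change m = 2 * (m / 2)
    omega
  · change m = 2 * (m / 2) + 1
    omega

/-- The fraction represented by a numeral, in terms of the code of the numeral. -/
def numeralFrac (k : ℕ) : Frac :=
  (if k.unpair.1 % 2 = 0 then k.unpair.1 / 2 else 0,
    if k.unpair.1 % 2 = 0 then 0 else k.unpair.1 / 2 + 1, k.unpair.2)

theorem evalFrac_rat (s : List Frac) (k : ℕ) :
    (GTerm.rat (Equiv.intEquivNat.symm k.unpair.1) k.unpair.2.succPNat).evalFrac s =
      numeralFrac k := by
  simp only [GTerm.evalFrac, numeralFrac, intEquivNat_symm, Nat.natPred_succPNat]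
  split_ifs with h
  · rw [Int.toNat_natCast, Int.toNat_neg_natCast]
  · rw [Int.toNat_negSucc, Int.neg_negSucc, Int.toNat_natCast]

theorem primrec_numeralFrac : Primrec numeralFrac := by
  have h1 : Primrec fun k : ℕ => k.unpair.1 := fst.comp unpair
  have h2 : Primrec fun k : ℕ => k.unpair.1 / 2 := nat_div.comp h1 (const 2)
  have h3 : PrimrecPred fun k : ℕ => k.unpair.1 % 2 = 0 :=
    Primrec.eq.comp (nat_mod.comp h1 (const 2)) (const 0)
  exact pair (ite h3 h2 (const 0)) (pair (ite h3 (const 0) (succ.comp h2)) (snd.comp unpair))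

/-- Course-of-values recursion on codes: `l` lists the values for all smaller codes, so its length
is the current code, and the immediate subterms are looked up in it. -/
theorem primrec_evalFrac : Primrec₂ fun (s : List Frac) (i : ℕ) => (GTerm.ofNat i).evalFrac s := by
  let g : List Frac → List Frac → Frac := fun s l =>
    if l.length % 5 = 0 then numeralFrac (l.length / 5)
    else if l.length % 5 = 1 then s.getD (l.length / 5) (0, 0, 0)
    else if l.length % 5 = 2 then (l.getD (l.length / 5) (0, 0, 0)).neg
    else if l.length % 5 = 3 then (l.getD (l.length / 5).unpair.1 (0, 0, 0)).add
      (l.getD (l.length / 5).unpair.2 (0, 0, 0))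
    else (l.getD (l.length / 5).unpair.1 (0, 0, 0)).add
      (l.getD (l.length / 5).unpair.2 (0, 0, 0)).neg
  have hg : Primrec₂ g := by
    have hlen : Primrec fun p : List Frac × List Frac => p.2.length := list_length.comp snd
    have hdiv : Primrec fun p : List Frac × List Frac => p.2.length / 5 :=
      nat_div.comp hlen (const 5)
    have hmod : ∀ c : ℕ, PrimrecPred fun p : List Frac × List Frac => p.2.length % 5 = c :=
      fun c => Primrec.eq.comp (nat_mod.comp hlen (const 5)) (const c)
    have h1 : Primrec fun p : List Frac × List Frac =>
        p.2.getD (p.2.length / 5).unpair.1 (0, 0, 0) :=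
      primrec_getD snd (fst.comp (unpair.comp hdiv)) _
    have h2 : Primrec fun p : List Frac × List Frac =>
        p.2.getD (p.2.length / 5).unpair.2 (0, 0, 0) :=
      primrec_getD snd (snd.comp (unpair.comp hdiv)) _
    exact ite (hmod 0) (primrec_numeralFrac.comp hdiv) <|
      ite (hmod 1) (primrec_getD fst hdiv _) <|
      ite (hmod 2) (primrec_fracNeg.comp (primrec_getD snd hdiv _)) <|
      ite (hmod 3) (primrec_fracAdd.comp h1 h2) (primrec_fracAdd.comp h1 (primrec_fracNeg.comp h2))
  refine nat_strong_rec _ (Primrec₂.option_some_iff.2 hg) fun s n => ?_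
  congr 1
  simp only [g, List.length_map, List.length_range]
  -- Here `n / 5 < n` fails, but code 0 is a numeral and needs no lookup.
  by_cases hn : n = 0
  · subst hn
    rw [GTerm.ofNat]
    simp only [Nat.zero_mod, ↓reduceIte, ↓reduceDIte]
    exact (evalFrac_rat s _).symm
  · have hlt : n / 5 < n := by omega
    rw [getD_map_range _ _ hlt, getD_map_range _ _ ((Nat.unpair_left_le _).trans_lt hlt),
      getD_map_range _ _ ((Nat.unpair_right_le _).trans_lt hlt)]
    conv_rhs => rw [GTerm.ofNat]
    split_ifs
    · exact (evalFrac_rat s _).symm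
    all_goals rfl

theorem primrec_combination : Primrec₂ combination := by
  refine list_foldr (h := fun (a : List (ℕ × ℕ) × List Frac) (q : (ℕ × ℕ) × Frac) =>
    (((GTerm.ofNat q.1.2).evalFrac a.2).add ((GTerm.ofNat q.1.1).evalFrac a.2).neg).add q.2)
    fst (const (0, 0, 0)) ?_
  refine primrec_fracAdd.comp (primrec_fracAdd.comp ?_ (primrec_fracNeg.comp ?_))
    (snd.comp snd)
  · exact primrec_evalFrac.comp (snd.comp fst) (snd.comp (fst.comp snd))
  · exact primrec_evalFrac.comp (snd.comp fst) (fst.comp (fst.comp snd))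

theorem primrec_unitValues : Primrec unitValues :=
  list_append.comp (list_map list_range (Primrec₂.const _)) (const _)

theorem primrecPred_realizedBy :
    PrimrecPred fun x : (ℕ × List ℕ) × List Frac => RealizedBy x.1.1 x.1.2 x.2 := by
  refine primrecPred_forall_lt (fst.comp fst) (primrecPred_forall_lt
    (fst.comp (fst.comp fst)) (primrecPred_iff ?_ ?_))
  · exact nat_lt.comp
      (primrec_getD (snd.comp (fst.comp (fst.comp fst))) (snd.comp fst) 0)
      (primrec_getD (snd.comp (fst.comp (fst.comp fst))) snd 0)
  · exact primrecRel_fracLT.comp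
      (primrec_evalFrac.comp (snd.comp (fst.comp fst)) (snd.comp fst))
      (primrec_evalFrac.comp (snd.comp (fst.comp fst)) snd)

theorem primrecPred_refutedBy :
    PrimrecPred fun x : (ℕ × List ℕ) × List (ℕ × ℕ) => RefutedBy x.1.1 x.1.2 x.2 := by
  have hn : Primrec fun y : ((ℕ × List ℕ) × List (ℕ × ℕ)) × ℕ × ℕ => y.1.1.1 :=
    fst.comp (fst.comp fst)
  have hi : Primrec fun y : ((ℕ × List ℕ) × List (ℕ × ℕ)) × ℕ × ℕ => y.1.1.2.getD y.2.1 0 :=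
    primrec_getD (snd.comp (fst.comp fst)) (fst.comp snd) 0
  have hj : Primrec fun y : ((ℕ × List ℕ) × List (ℕ × ℕ)) × ℕ × ℕ => y.1.1.2.getD y.2.2 0 :=
    primrec_getD (snd.comp (fst.comp fst)) (snd.comp snd) 0
  have h0 : Primrec fun x : (ℕ × List ℕ) × List (ℕ × ℕ) => combination x.2 [] :=
    primrec_combination.comp snd (const [])
  have h0' : Primrec fun y : ((ℕ × List ℕ) × List (ℕ × ℕ)) × ℕ => combination y.1.2 [] :=
    h0.comp fst
  have hu : Primrec fun y : ((ℕ × List ℕ) × List (ℕ × ℕ)) × ℕ =>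
      combination y.1.2 (unitValues y.2) :=
    primrec_combination.comp (snd.comp fst) (primrec_unitValues.comp snd)
  refine PrimrecPred.and ?_ (PrimrecPred.and ?_ (PrimrecPred.or ?_ (PrimrecPred.and ?_ ?_)))
  · exact primrecPred_forall_mem snd (PrimrecPred.and (nat_lt.comp (fst.comp snd) hn)
      (PrimrecPred.and (nat_lt.comp (snd.comp snd) hn) (nat_le.comp hi hj)))
  · exact primrecPred_forall_lt (fst.comp fst) (PrimrecPred.and
      (primrecRel_fracLT.comp hu h0').not (primrecRel_fracLT.comp h0' hu).not)
  · exact primrecRel_fracLT.comp h0 (const (0, 0, 0))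
  · exact (primrecRel_fracLT.comp (const (0, 0, 0)) h0).not
  · exact primrecPred_exists_mem snd (nat_lt.comp hi hj)

end Frac

/-! ### Satisfiability on grids -/

section Grid

open Primrec

variable {α : Type*} [Primcodable α]

theorem primrec_cmpCode : Primrec₂ (cmpCode : ℕ → ℕ → ℕ) :=
  ite nat_lt (const 0) (ite (nat_lt.comp snd fst) (const 1) (const 2))

theorem primrec_tupleType :
    Primrec₂ (tupleType : List ℕ → List (ℕ ⊕ ℕ) → List ((List ℕ × List ℕ) ⊕ ℕ)) := by
  have h1 : Primrec₂ fun (x : (List ℕ × List (ℕ ⊕ ℕ)) × (ℕ ⊕ ℕ)) (p : ℕ) =>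
      x.1.1.map (cmpCode p) :=
    list_map (fst.comp (fst.comp fst)) (primrec_cmpCode.comp (snd.comp fst) snd)
  have h2 : Primrec₂ fun (x : (List ℕ × List (ℕ ⊕ ℕ)) × (ℕ ⊕ ℕ)) (p : ℕ) =>
      x.1.2.map (Sum.elim (cmpCode p) fun _ => 3) :=
    list_map (snd.comp (fst.comp fst)) (primrec_sumElim snd
      (primrec_cmpCode.comp (snd.comp (fst.comp fst)) snd) (const 3))
  refine (list_map (g := fun (x : List ℕ × List (ℕ ⊕ ℕ)) (a : ℕ ⊕ ℕ) => Sum.elim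
    (fun p => (Sum.inl (x.1.map (cmpCode p), x.2.map (Sum.elim (cmpCode p) fun _ => 3)) :
      (List ℕ × List ℕ) ⊕ ℕ)) (fun c => Sum.inr c) a) snd ?_).of_eq fun x => ?_
  · exact primrec_sumElim snd (sumInl.comp (pair h1 h2)) (sumInr.comp snd)
  · refine List.map_congr_left fun a _ => ?_
    cases a <;> rfl

theorem primrecPred_holdsNat {r : α → Rel} {f g : α → ℕ} (hr : Primrec r) (hf : Primrec f)
    (hg : Primrec g) : PrimrecPred fun a => (r a).HoldsNat (f a) (g a) := by
  have h : ∀ s : Rel, PrimrecPred fun a => r a = s := fun s => Primrec.eq.comp hr (const s)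
  have hlt : PrimrecPred fun a => f a < g a := nat_lt.comp hf hg
  have hgt : PrimrecPred fun a => g a < f a := nat_lt.comp hg hf
  refine (((h .lt).and hlt).or (((h .le).and hgt.not).or (((h .eq).and (hlt.not.and hgt.not)).or
    (((h .ne).and (hlt.or hgt)).or (((h .ge).and hlt.not).or ((h .gt).and hgt)))))).of_eq
    fun a => ?_
  cases r a <;> (simp [Rel.HoldsNat]; try omega)

theorem primrec_toNat : Primrec GTerm.toNat := Primrec.encode

theorem primrecPred_constraintGridHolds :
    PrimrecPred fun x : (List ℕ × List ℕ) × Constraint => x.2.GridHolds x.1.1 x.1.2 := by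
  have he : Primrec Constraint.equiv := Primrec.of_equiv
  have hc {β : Type} [Primcodable β] {f : β → GTerm} {c : β → List ℕ} (hc : Primrec c)
      (hf : Primrec f) : Primrec fun y => (c y).getD (f y).toNat 0 :=
    primrec_getD hc (primrec_toNat.comp hf) 0
  refine (primrecPred_sumElim
    (p := fun (x : (List ℕ × List ℕ) × Constraint) (y : GTerm × Rel × GTerm) =>
      y.2.1.HoldsNat (x.1.1.getD y.1.toNat 0) (x.1.1.getD y.2.2.toNat 0))
    (q := fun x => Sum.elim
      (fun y => y.2.1.HoldsNat (x.1.2.getD y.1 0) (x.1.1.getD y.2.2.toNat 0))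
      (fun y => y.2.1.HoldsNat (x.1.2.getD y.1 0) (x.1.2.getD y.2.2 0)))
    (he.comp snd) ?_ ?_).of_eq fun x => ?_
  · exact primrecPred_holdsNat (fst.comp (snd.comp snd))
      (hc (fst.comp (fst.comp fst)) (fst.comp snd))
      (hc (fst.comp (fst.comp fst)) (snd.comp (snd.comp snd)))
  · refine primrecPred_sumElim snd ?_ ?_
    · exact primrecPred_holdsNat (fst.comp (snd.comp snd))
        (primrec_getD (snd.comp (fst.comp (fst.comp fst))) (fst.comp snd) 0)
        (hc (fst.comp (fst.comp (fst.comp fst))) (snd.comp (snd.comp snd)))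
    · exact primrecPred_holdsNat (fst.comp (snd.comp snd))
        (primrec_getD (snd.comp (fst.comp (fst.comp fst))) (fst.comp snd) 0)
        (primrec_getD (snd.comp (fst.comp (fst.comp fst))) (snd.comp (snd.comp snd)) 0)
  · obtain ⟨⟨c, b⟩, _ | _ | _⟩ := x <;> rfl

theorem primrec_termGridVal {e f : α → List ℕ} {s : α → FTerm} (he : Primrec e)
    (hf : Primrec f) (hs : Primrec s) : Primrec fun a => (s a).gridVal (e a) (f a) := by
  have h : Primrec FTerm.equiv := Primrec.of_equiv
  refine (primrec_sumElim (g := fun a (v : ℕ) => (e a).getD ((f a).getD v 0) 0)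
    (h := fun a c => (e a).getD c 0) (h.comp hs) ?_ ?_).of_eq fun a => ?_
  · exact primrec_getD (he.comp fst) (primrec_getD (hf.comp fst) snd 0) 0
  · exact primrec_getD (he.comp fst) snd 0
  · cases s a <;> rfl

theorem primrec_argGridVal {e b f : α → List ℕ} {s : α → Arg} (he : Primrec e) (hb : Primrec b)
    (hf : Primrec f) (hs : Primrec s) : Primrec fun a => (s a).gridVal (e a) (b a) (f a) := by
  have h : Primrec Arg.equiv := Primrec.of_equiv
  refine (primrec_sumElim (g := fun a (v : ℕ) => (Sum.inl ((b a).getD v 0) : ℕ ⊕ ℕ))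
    (h := fun a (t : FTerm) => Sum.inr (t.gridVal (e a) (f a))) (h.comp hs) ?_ ?_).of_eq
    fun a => ?_
  · exact sumInl.comp (primrec_getD (hb.comp fst) snd 0)
  · exact sumInr.comp (primrec_termGridVal (he.comp fst) (hf.comp fst) snd)
  · cases s a <;> rfl

/-- The parameters of an evaluation on a grid: the cuts, the values of the free constants, the
types that hold, and the values of the variables. -/
abbrev GridParams := (List ℕ × List ℕ × List GroundType) × List ℕ × List ℕ

theorem primrecPred_eqGridHolds : PrimrecRel fun (x : GridParams × Atom) (y : FTerm × FTerm) =>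
    y.1.gridVal x.1.1.2.1 x.1.2.2 = y.2.gridVal x.1.1.2.1 x.1.2.2 := by
  have he : Primrec fun z : (GridParams × Atom) × FTerm × FTerm => z.1.1.1.2.1 :=
    fst.comp (snd.comp (fst.comp (fst.comp fst)))
  have hf : Primrec fun z : (GridParams × Atom) × FTerm × FTerm => z.1.1.2.2 :=
    snd.comp (snd.comp (fst.comp fst))
  exact Primrec.eq.comp (primrec_termGridVal he hf (fst.comp snd))
    (primrec_termGridVal he hf (snd.comp snd))

theorem primrecPred_predGridHolds :
    PrimrecRel fun (x : GridParams × Atom) (y : ℕ × List Arg) => (y.1, tupleType x.1.1.1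
      (y.2.map (Arg.gridVal x.1.1.2.1 x.1.2.1 x.1.2.2))) ∈ x.1.1.2.2 := by
  have hp : Primrec fun z : ((GridParams × Atom) × ℕ × List Arg) × Arg => z.1.1.1 :=
    fst.comp (fst.comp fst)
  have harg : Primrec₂ fun (y : (GridParams × Atom) × ℕ × List Arg) (a : Arg) =>
      a.gridVal y.1.1.1.2.1 y.1.1.2.1 y.1.1.2.2 :=
    primrec_argGridVal (fst.comp (snd.comp (fst.comp hp))) (fst.comp (snd.comp hp))
      (snd.comp (snd.comp hp)) snd
  have htype : Primrec fun y : (GridParams × Atom) × ℕ × List Arg => tupleType y.1.1.1.1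
      (y.2.2.map (Arg.gridVal y.1.1.1.2.1 y.1.1.2.1 y.1.1.2.2)) :=
    primrec_tupleType.comp (fst.comp (fst.comp (fst.comp fst)))
      (list_map (snd.comp snd) harg)
  have hV : Primrec fun y : (GridParams × Atom) × ℕ × List Arg => y.1.1.1.2.2 :=
    snd.comp (snd.comp (fst.comp (fst.comp fst)))
  exact primrecPred_mem (pair (fst.comp snd) htype) hV

theorem primrecPred_atomGridHolds : PrimrecPred fun x : GridParams × Atom =>
    x.2.GridHolds x.1.1.1 x.1.1.2.1 x.1.1.2.2 x.1.2.1 x.1.2.2 := by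
  have he : Primrec Atom.equiv := Primrec.of_equiv
  refine (primrecPred_sumElim (he.comp snd) primrecPred_eqGridHolds
    primrecPred_predGridHolds).of_eq fun x => ?_
  obtain ⟨p, _ | _⟩ := x <;> rfl

theorem primrecPred_clauseGridHolds : PrimrecPred fun x : GridParams × Clause =>
    x.2.GridHolds x.1.1.1 x.1.1.2.1 x.1.1.2.2 x.1.2.1 x.1.2.2 := by
  have he : Primrec Clause.equiv := Primrec.of_equiv
  have h1 : Primrec Clause.constraints := fst.comp he
  have h2 : Primrec Clause.antecedent := fst.comp (snd.comp he)
  have h3 : Primrec Clause.succedent := snd.comp (snd.comp he)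
  have ha : PrimrecRel fun (x : GridParams × Clause) (a : Atom) =>
      a.GridHolds x.1.1.1 x.1.1.2.1 x.1.1.2.2 x.1.2.1 x.1.2.2 :=
    primrecPred_atomGridHolds.comp (pair (fst.comp fst) snd)
  have hc : PrimrecRel fun (x : GridParams × Clause) (a : Constraint) =>
      a.GridHolds x.1.1.1 x.1.2.1 :=
    primrecPred_constraintGridHolds.comp (pair (pair (fst.comp (fst.comp (fst.comp fst)))
      (fst.comp (snd.comp (fst.comp fst)))) snd)
  exact primrecPred_imp ((primrecPred_forall_mem (h1.comp snd) hc).and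
    (primrecPred_forall_mem (h2.comp snd) ha)) (primrecPred_exists_mem (h3.comp snd) ha)

theorem primrec_scale : Primrec₂ scale :=
  list_map snd (nat_mul.comp (succ.comp snd) (succ.comp (fst.comp fst)))

theorem primrec_gridSize : Primrec gridSize :=
  nat_mul.comp (nat_add.comp Primrec.id (const 2)) succ

theorem primrec_gridArgs : Primrec gridArgs :=
  list_append.comp (list_map (list_range.comp primrec_gridSize) (sumInl.comp snd))
    (list_map list_range (sumInr.comp snd))

theorem primrec_gridTypes : Primrec₂ gridTypes := by
  have h : Primrec gridTuples := by
    refine list_flatMap list_range (list_flatMap (list_range.comp fst) (list_map ?_ ?_))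
    · exact primrec_words.comp (primrec_gridArgs.comp (fst.comp fst)) snd
    · exact pair (snd.comp (fst.comp fst)) snd
  exact list_map (h.comp fst) (pair (fst.comp snd)
    (primrec_tupleType.comp (snd.comp fst) (snd.comp snd)))

theorem primrecPred_gridModel :
    PrimrecPred fun x : (ℕ × List ℕ × List ℕ × List GroundType) × ClauseSet =>
      GridModel x.1.1 x.1.2.1 x.1.2.2.1 x.1.2.2.2 x.2 := by
  refine primrecPred_forall_mem snd (primrecPred_forall_mem
    (f := fun y : ((ℕ × List ℕ × List ℕ × List GroundType) × ClauseSet) × Clause =>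
      words (List.range (gridSize y.1.1.1)) y.1.1.1) ?_ (primrecPred_forall_mem
    (f := fun y : (((ℕ × List ℕ × List ℕ × List GroundType) × ClauseSet) × Clause) × List ℕ =>
      words (List.range y.1.1.1.1) y.1.1.1.1) ?_ ?_))
  · exact primrec_words.comp (list_range.comp (primrec_gridSize.comp (fst.comp (fst.comp fst))))
      (fst.comp (fst.comp fst))
  · exact primrec_words.comp (list_range.comp (fst.comp (fst.comp (fst.comp fst))))
      (fst.comp (fst.comp (fst.comp fst)))
  · exact primrecPred_clauseGridHolds.comp (pair (pair (snd.comp (fst.comp (fst.comp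
      (fst.comp fst)))) (pair (snd.comp fst) snd)) (snd.comp (fst.comp fst)))

theorem primrecPred_gridSatisfiable : PrimrecPred fun x : (ℕ × List ℕ) × ClauseSet =>
    GridSatisfiable x.1.1 x.1.2 x.2 := by
  have hs : Primrec fun x : (ℕ × List ℕ) × ClauseSet => scale x.1.1 x.1.2 :=
    primrec_scale.comp (fst.comp fst) (snd.comp fst)
  refine primrecPred_exists_mem (primrec_words.comp (list_range.comp (fst.comp fst))
    (fst.comp fst)) (primrecPred_exists_mem (primrec_subsets.comp (primrec_gridTypes.comp
    (fst.comp (fst.comp fst)) (hs.comp fst))) ?_)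
  exact primrecPred_gridModel.comp (pair (pair (fst.comp (fst.comp (fst.comp fst)))
    (pair (hs.comp (fst.comp fst)) (pair (snd.comp fst) snd))) (snd.comp (fst.comp fst)))

end Grid

/-! ### Decidability -/

open Primrec

theorem primrec_bound : Primrec bound := succ.comp Primrec.encode

theorem primrec_orderTypes : Primrec fun N : ClauseSet => words (List.range (bound N)) (bound N) :=
  primrec_words.comp (list_range.comp primrec_bound) primrec_bound

/-- The search runs over codes of rational solutions; an order type realized by reals cannot be
refuted, so it has one. -/
theorem rePred_satisfiable : REPred fun N : ClauseSet => Satisfiable.{u} N := by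
  refine rePred_of_exists (q := fun N k => ∃ ρ ∈ words (List.range (bound N)) (bound N),
    RealizedBy (bound N) ρ ((decode (α := List Frac) k).getD []) ∧
      GridSatisfiable (bound N) ρ N) ?_ fun N => ?_
  · refine primrecPred_exists_mem (primrec_orderTypes.comp fst) (PrimrecPred.and ?_ ?_)
    · exact primrecPred_realizedBy.comp (pair (pair (primrec_bound.comp (fst.comp fst)) snd)
        (option_getD.comp (Primrec.decode.comp (snd.comp fst)) (const [])))
    · exact primrecPred_gridSatisfiable.comp (pair (pair (primrec_bound.comp (fst.comp fst)) snd)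
        (fst.comp fst))
  · rw [satisfiable_iff]
    constructor
    · rintro ⟨ρ, hρ, ⟨σ, hσ⟩, h⟩
      rcases exists_realizedBy_or_exists_refutedBy (bound N) ρ with ⟨s, hs⟩ | ⟨W, hW⟩
      · exact ⟨encode s, ρ, hρ, by simpa using hs, h⟩
      · exact absurd hσ (hW.not_orderTypeAt σ)
    · rintro ⟨k, ρ, hρ, hs, h⟩
      exact ⟨ρ, hρ, hs.orderTypeAt, h⟩

/-- Every order type passing the grid test must be refuted. There are finitely many, so one bound
`B` on the codes of the refutations suffices, and for fixed `B` the check is primitive recursive. -/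
theorem rePred_not_satisfiable : REPred fun N : ClauseSet => ¬ Satisfiable.{u} N := by
  refine rePred_of_exists (q := fun N B => ∀ ρ ∈ words (List.range (bound N)) (bound N),
    GridSatisfiable (bound N) ρ N →
      ∃ k < B, RefutedBy (bound N) ρ ((decode (α := List (ℕ × ℕ)) k).getD [])) ?_ fun N => ?_
  · refine primrecPred_forall_mem (primrec_orderTypes.comp fst) (primrecPred_imp ?_
      (primrecPred_exists_lt (snd.comp fst) ?_))
    · exact primrecPred_gridSatisfiable.comp (pair (pair (primrec_bound.comp (fst.comp fst)) snd)
        (fst.comp fst))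
    · exact primrecPred_refutedBy.comp (pair (pair (primrec_bound.comp (fst.comp
        (fst.comp fst))) (snd.comp fst)) (option_getD.comp (Primrec.decode.comp snd) (const [])))
  · rw [satisfiable_iff]
    constructor
    · intro h
      have hW : ∀ ρ, ∃ W, ρ ∈ words (List.range (bound N)) (bound N) →
          GridSatisfiable (bound N) ρ N → RefutedBy (bound N) ρ W := by
        intro ρ
        by_cases hρ : ρ ∈ words (List.range (bound N)) (bound N) ∧ GridSatisfiable (bound N) ρ N
        · rcases exists_realizedBy_or_exists_refutedBy (bound N) ρ with ⟨s, hs⟩ | ⟨W, hW⟩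
          · exact absurd ⟨ρ, hρ.1, hs.orderTypeAt, hρ.2⟩ h
          · exact ⟨W, fun _ _ => hW⟩
        · exact ⟨[], fun h1 h2 => absurd ⟨h1, h2⟩ hρ⟩
      choose W hW using hW
      obtain ⟨B, hB⟩ := ((words (List.range (bound N)) (bound N)).toFinset.image
        fun ρ => encode (W ρ)).exists_le
      refine ⟨B + 1, fun ρ hρ hg => ⟨encode (W ρ), Nat.lt_succ_of_le (hB _ ?_), ?_⟩⟩
      · exact Finset.mem_image_of_mem _ (List.mem_toFinset.2 hρ)
      · simpa using hW ρ hρ hg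
    · rintro ⟨B, hB⟩ ⟨ρ, hρ, ⟨σ, hσ⟩, hg⟩
      obtain ⟨k, -, hk⟩ := hB ρ hρ hg
      exact hk.not_orderTypeAt σ hσ

end BSRSLR

theorem theorem1 :
    ComputablePred (fun N : BSRSLR.ClauseSet => BSRSLR.Satisfiable.{u} N) :=
  ComputablePred.computable_iff_re_compl_re'.2
    ⟨BSRSLR.rePred_satisfiable, BSRSLR.rePred_not_satisfiable⟩
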